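/- Let $X=\{0,1\}$, let $X^*$ be the set of finite words over $X$, viewed as a rooted binary tree with edges $w\to wx$ ($w\in X^*$, $x\in X$), and let $G=\mathrm{Aut}(X^*)$ be its group of graph automorphisms. For $n\ge 0$ let $G(n)$ be the automorphism group of the finite subtree of words of length at most $n$, and let $\pi_n\colon G\to G(n)$ be restriction. For $g\in G$ and $w\in X^*$ the section $g_w\in G$ is defined by $g(wv)=g(w)\,g_w(v)$ for all $v\in X^*$; for $p\in G(n)$ and a word $w$ of length $|w|\le n$ the finite section $p_w\in G(n-|w|)$ is defined in the same way. A subgroup $P\le G(k)$, $k\ge 1$, is an essential pattern group of size $k$ if for every $p\in P$ and $i\in X$ there is $q\in P$ whose restriction to words of length at most $k-1$ equals $p_i$; it defines the group $G_P=\{g\in G : \pi_k(g_w)\in P \text{ for all } w\in X^*\}$. A subgroup $H\le G$ is a finitely constrained group defined by patterns of size $d$ if $d$ is the least $k\ge 1$ such that $H=G_P$ for some essential pattern group $P$ of size $k$. Equip $G$ with the profinite metric $d_G(g,g)=0$ and, for $g\ne h$, $d_G(g,h)=1/|G(n)|$, where $n\ge 0$ is the largest integer with $\pi_n(g)=\pi_n(h)$;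 let $\operatorname{Hdim}(H)$ denote the Hausdorff dimension of $H\subseteq G$ with respect to this metric. The portrait map $\rho\colon G\to (C_2)^{X^*}$ sends $g$ to the function whose value at $w$ is the nontrivial element of $C_2$ if $g_w$ exchanges the words $0$ and $1$, and the trivial element otherwise. **Theorem.** Let $d\ge 2$ and let $H\le G$ be a finitely constrained group defined by patterns of size $d$ with $\operatorname{Hdim}(H)=1-\frac{2}{2^{d-1}}$. Then $H$ has additive portraits, that is, $\rho(H)$ is a subgroup of $(C_2)^{X^*}$ with respect to the pointwise operation. -/

import Mathlib

/-! Automorphisms of the rooted binary tree, patterns, finitely constrained groups, portraits and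
the profinite metric. -/

namespace BinTree

/-- The vertices of the binary tree: the finite words over `X = {0, 1}`, the root being `[]`. -/
abbrev Word := List (Fin 2)

/-- The edges of the tree: `v → vx` for a word `v` and a letter `x`. -/
def Edge (v w : Word) : Prop := ∃ x : Fin 2, w = v ++ [x]

/-- `G = Aut(X^*)`: the group of all graph automorphisms of the infinite rooted binary tree.
The product `g * h` is the composition `v ↦ g (h v)`. -/
abbrev TreeAut := Edge ≃r Edge

/-- The edges of the finite tree `X^{[d]}` of the words of length at most `d`. -/
abbrev FinEdge (d : ℕ) := Subrel Edge (fun w : Word => w.length ≤ d)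

/-- `G(d) = Aut(X^{[d]})`: the group of all graph automorphisms of the finite tree. -/
abbrev FinTreeAut (d : ℕ) := FinEdge d ≃r FinEdge d

theorem edge_append (u v w : Word) : Edge (u ++ v) (u ++ w) ↔ Edge v w := by
  simp [Edge, List.append_assoc]

theorem Edge.length {v w : Word} (h : Edge v w) : w.length = v.length + 1 := by
  obtain ⟨x, rfl⟩ := h
  simp

theorem not_edge_nil (v : Word) : ¬ Edge v [] := fun h => by
  have := h.length
  simp at this

/-! ### Sections in the infinite tree -/

theorem map_nil (g : TreeAut) : g [] = [] := by
  rcases List.eq_nil_or_concat (g []) with h | ⟨u, x, h⟩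
  · exact h
  · exfalso
    have h1 : Edge (g (g.symm u)) (g []) := ⟨x, by simp [h]⟩
    exact not_edge_nil _ (g.map_rel_iff.1 h1)

theorem map_concat (g : TreeAut) (w : Word) (x : Fin 2) : Edge (g w) (g (w ++ [x])) :=
  g.map_rel_iff.2 ⟨x, rfl⟩

theorem length_map (g : TreeAut) (w : Word) : (g w).length = w.length := by
  induction w using List.reverseRecOn with
  | nil => simp [map_nil]
  | append_singleton w x ih => simp [(map_concat g w x).length, ih]

theorem prefix_map (g : TreeAut) (w v : Word) : g w <+: g (w ++ v) := by
  induction v using List.reverseRecOn with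
  | nil => simp
  | append_singleton v x ih =>
    obtain ⟨y, hy⟩ := map_concat g (w ++ v) x
    rw [← List.append_assoc, hy]
    exact ih.trans (List.prefix_append _ _)

theorem map_append (g : TreeAut) (w v : Word) :
    g (w ++ v) = g w ++ (g (w ++ v)).drop w.length := by
  obtain ⟨t, ht⟩ := prefix_map g w v
  rw [← ht, ← length_map g w, List.drop_left]

/-- The section `g_w` of `g` at `w`: the automorphism with `g (w v) = g(w) g_w(v)`. -/
def treeSection (g : TreeAut) (w : Word) : TreeAut where
  toFun v := (g (w ++ v)).drop w.length
  invFun v := (g.symm (g w ++ v)).drop w.length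
  left_inv v := by
    dsimp only
    rw [← map_append]
    simp
  right_inv v := by
    dsimp only
    have h := map_append g.symm (g w) v
    rw [length_map, g.symm_apply_apply] at h
    rw [← h]
    simp [← length_map g w]
  map_rel_iff' {a b} := by
    change Edge ((g (w ++ a)).drop w.length) ((g (w ++ b)).drop w.length) ↔ _
    rw [← edge_append (g w), ← map_append, ← map_append, g.map_rel_iff, edge_append]

theorem treeSection_spec (g : TreeAut) (w v : Word) : g (w ++ v) = g w ++ treeSection g w v :=
  map_append g w v

/-! ### Restriction to finite levels -/

/-- The restriction `π_d : G → G(d)`. -/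
def res (d : ℕ) : TreeAut →* FinTreeAut d where
  toFun g :=
    { toFun := fun v => ⟨g v.1, (length_map g v.1).le.trans v.2⟩
      invFun := fun v => ⟨g.symm v.1, (length_map g.symm v.1).le.trans v.2⟩
      left_inv := fun v => Subtype.ext (g.symm_apply_apply v.1)
      right_inv := fun v => Subtype.ext (g.apply_symm_apply v.1)
      map_rel_iff' := g.map_rel_iff }
  map_one' := rfl
  map_mul' _ _ := rfl

theorem fin_map_nil {d : ℕ} (p : FinTreeAut d) : (p ⟨[], Nat.zero_le d⟩).1 = [] := by
  rcases List.eq_nil_or_concat (p ⟨[], Nat.zero_le d⟩).1 with h | ⟨u, x, h⟩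
  · exact h
  · exfalso
    have hd := (p ⟨[], Nat.zero_le d⟩).2
    have hu : u.length ≤ d := by
      rw [h] at hd
      simp at hd
      omega
    have h1 : FinEdge d (p (p.symm ⟨u, hu⟩)) (p ⟨[], Nat.zero_le d⟩) := by
      rw [p.apply_symm_apply]
      exact ⟨x, by simpa using h⟩
    exact not_edge_nil _ (p.map_rel_iff.1 h1)

theorem fin_map_edge {d : ℕ} (p : FinTreeAut d) {v w : Word} (hv : v.length ≤ d)
    (hw : w.length ≤ d) (h : Edge v w) : Edge (p ⟨v, hv⟩).1 (p ⟨w, hw⟩).1 :=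
  p.map_rel_iff.2 (show FinEdge d ⟨v, hv⟩ ⟨w, hw⟩ from h)

theorem fin_length_map {d : ℕ} (p : FinTreeAut d) (w : Word) (hw : w.length ≤ d) :
    (p ⟨w, hw⟩).1.length = w.length := by
  induction w using List.reverseRecOn with
  | nil => simp [fin_map_nil]
  | append_singleton w x ih =>
    have hw' : w.length ≤ d := by simp at hw; omega
    simp [(fin_map_edge p hw' hw ⟨x, rfl⟩).length, ih hw']

theorem fin_prefix_map {d : ℕ} (p : FinTreeAut d) (w v : Word) (hw : w.length ≤ d)
    (hwv : (w ++ v).length ≤ d) : (p ⟨w, hw⟩).1 <+: (p ⟨w ++ v, hwv⟩).1 := by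
  induction v using List.reverseRecOn with
  | nil => simp
  | append_singleton v x ih =>
    have h1 : (w ++ v).length ≤ d := by simp at hwv ⊢; omega
    obtain ⟨y, hy⟩ := fin_map_edge p h1 hwv ⟨x, by simp⟩
    rw [hy]
    exact (ih h1).trans (List.prefix_append _ _)

theorem fin_map_append {d : ℕ} (p : FinTreeAut d) (w v : Word) (hw : w.length ≤ d)
    (hwv : (w ++ v).length ≤ d) :
    (p ⟨w ++ v, hwv⟩).1 = (p ⟨w, hw⟩).1 ++ (p ⟨w ++ v, hwv⟩).1.drop w.length := by
  obtain ⟨t, ht⟩ := fin_prefix_map p w v hw hwv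
  rw [← ht]
  conv_rhs => rw [← fin_length_map p w hw, List.drop_left]

/-- The restriction `π_{n,k} : G(n) → G(k)` for `k ≤ n`. -/
def finRes {n k : ℕ} (h : k ≤ n) : FinTreeAut n →* FinTreeAut k where
  toFun p :=
    { toFun := fun v => ⟨(p ⟨v.1, v.2.trans h⟩).1, (fin_length_map p v.1 _).le.trans v.2⟩
      invFun := fun v =>
        ⟨(p.symm ⟨v.1, v.2.trans h⟩).1, (fin_length_map p.symm v.1 _).le.trans v.2⟩
      left_inv := fun v => by simp
      right_inv := fun v => by simp
      map_rel_iff' := fun {a b} => p.map_rel_iff (a := ⟨a.1, a.2.trans h⟩)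
        (b := ⟨b.1, b.2.trans h⟩) }
  map_one' := rfl
  map_mul' _ _ := rfl

theorem finRes_res {n k : ℕ} (h : k ≤ n) (g : TreeAut) : finRes h (res n g) = res k g := rfl

theorem length_append_le {d : ℕ} {w v : Word} (hw : w.length ≤ d) (hv : v.length ≤ d - w.length) :
    (w ++ v).length ≤ d := by
  simp
  omega

/-- The finite section `p_w ∈ G(d - |w|)` of `p ∈ G(d)` at a word `w` of length at most `d`:
the automorphism with `p (w v) = p(w) p_w(v)`. -/
def finSection {d : ℕ} (p : FinTreeAut d) (w : Word) (hw : w.length ≤ d) :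
    FinTreeAut (d - w.length) where
  toFun v := ⟨(p ⟨w ++ v.1, length_append_le hw v.2⟩).1.drop w.length, by
    rw [List.length_drop, fin_length_map]
    simpa using v.2⟩
  invFun v := ⟨(p.symm ⟨(p ⟨w, hw⟩).1 ++ v.1, by
      rw [List.length_append, fin_length_map]
      have := v.2
      omega⟩).1.drop w.length, by
    rw [List.length_drop, fin_length_map, List.length_append, fin_length_map]
    simpa using v.2⟩
  left_inv v := by
    apply Subtype.ext
    simp only [← fin_map_append]
    simp
  right_inv v := by
    apply Subtype.ext
    have hl : ((p ⟨w, hw⟩).1 ++ v.1).length ≤ d := by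
      rw [List.length_append, fin_length_map]
      have := v.2
      omega
    have h := fin_map_append p.symm (p ⟨w, hw⟩).1 v.1 (p ⟨w, hw⟩).2 hl
    simp only [fin_length_map, Subtype.coe_eta, p.symm_apply_apply] at h
    simp only [← h]
    simp [← fin_length_map p w hw]
  map_rel_iff' {a b} := by
    change Edge ((p ⟨w ++ a.1, _⟩).1.drop w.length) ((p ⟨w ++ b.1, _⟩).1.drop w.length) ↔
      Edge a.1 b.1
    rw [← edge_append (p ⟨w, hw⟩).1, ← fin_map_append, ← fin_map_append,
      ← edge_append w a.1 b.1]
    exact p.map_rel_iff (a := ⟨w ++ a.1, length_append_le hw a.2⟩)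
      (b := ⟨w ++ b.1, length_append_le hw b.2⟩)

theorem finSection_spec {d : ℕ} (p : FinTreeAut d) (w v : Word) (hw : w.length ≤ d)
    (hv : v.length ≤ d - w.length) :
    (p ⟨w ++ v, length_append_le hw hv⟩).1 = (p ⟨w, hw⟩).1 ++ (finSection p w hw ⟨v, hv⟩).1 :=
  fin_map_append p w v hw _

/-! ### Finitely constrained groups -/

/-- A subgroup `P` of `G(d)`, `d ≥ 1`, is an essential pattern group (of pattern size `d`) if for
every `p ∈ P` and every letter `i` there is `q ∈ P` with `π_{d-1}(q) = p_i`. Note that `G(d)` acts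
on the words of length at most `d`, so its elements are determined by the `C_2`-labels on the
words of length less than `d`. -/
def IsEssentialPatternGroup {d : ℕ} (P : Subgroup (FinTreeAut d)) : Prop :=
  ∃ hd : 1 ≤ d, ∀ p ∈ P, ∀ i : Fin 2, ∃ q ∈ P,
    finRes (k := d - 1) (Nat.sub_le d 1) q = finSection p [i] hd

theorem treeSection_one (w : Word) : treeSection 1 w = 1 := by
  ext v : 1
  simp [treeSection]

theorem treeSection_mul (g h : TreeAut) (w : Word) :
    treeSection (g * h) w = treeSection g (h w) * treeSection h w := by
  ext v : 1
  apply List.append_cancel_left (as := (g * h) w)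
  rw [← treeSection_spec, RelIso.mul_apply, treeSection_spec h, treeSection_spec g]
  rfl

theorem treeSection_inv (g : TreeAut) (w : Word) :
    treeSection g⁻¹ w = (treeSection g (g⁻¹ w))⁻¹ := by
  rw [eq_inv_iff_mul_eq_one]
  have h := treeSection_mul g⁻¹ g (g⁻¹ w)
  rw [inv_mul_cancel, treeSection_one, RelIso.apply_inv_self] at h
  exact h.symm

/-- The group `G_P` defined by `P`: all `g` with `π_d(g_w) ∈ P` for all words `w`. -/
def definedGroup {d : ℕ} (P : Subgroup (FinTreeAut d)) : Subgroup TreeAut where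
  carrier := {g | ∀ w : Word, res d (treeSection g w) ∈ P}
  one_mem' w := by
    rw [treeSection_one, map_one]
    exact P.one_mem
  mul_mem' {g h} hg hh w := by
    rw [treeSection_mul, map_mul]
    exact P.mul_mem (hg _) (hh _)
  inv_mem' {g} hg w := by
    rw [treeSection_inv, map_inv]
    exact P.inv_mem (hg _)

/-- `H` is a finitely constrained group defined by patterns of size `d`: the number `d` is the
least size of an essential pattern group `P` with `H = G_P`. -/
def IsDefinedByPatternsOfSize (H : Subgroup TreeAut) (d : ℕ) : Prop :=
  IsLeast {k : ℕ | ∃ P : Subgroup (FinTreeAut k), IsEssentialPatternGroup P ∧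
    H = definedGroup P} d

/-! ### Portraits -/

/-- The portrait map `ρ : Aut(X^*) → (C_2)^{X^*}`. The group `C_2` is `ZMod 2`, and the label of
`g` at `w` is `1` if the section `g_w` swaps the words `0` and `1`, and is `0` otherwise. -/
def portrait (g : TreeAut) : Word → ZMod 2 :=
  fun w => if treeSection g w [0] = [1] then 1 else 0

/-- `H` has additive portraits: `ρ(H)` is a subgroup of the group `(C_2)^{X^*}` with the pointwise
operation. -/
def HasAdditivePortraits (H : Subgroup TreeAut) : Prop :=
  ∃ K : AddSubgroup (Word → ZMod 2), (K : Set (Word → ZMod 2)) = portrait '' (H : Set TreeAut)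

/-! ### The profinite metric -/

/-- The extension of `p ∈ G(n)` to the infinite tree with trivial sections at level `n`. -/
def extend {n : ℕ} (p : FinTreeAut n) : TreeAut :=
  have len : ∀ (q : FinTreeAut n) (w : Word),
      (q ⟨w.take n, List.length_take_le n w⟩).1.length = min n w.length := fun q w => by
    rw [fin_length_map, List.length_take]
  have inv : ∀ (q r : FinTreeAut n), (∀ v, r (q v) = v) → ∀ w : Word,
      (r ⟨((q ⟨w.take n, List.length_take_le n w⟩).1 ++ w.drop n).take n,
        List.length_take_le n _⟩).1 ++
        ((q ⟨w.take n, List.length_take_le n w⟩).1 ++ w.drop n).drop n = w := fun q r hqr w => by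
    have key : ((q ⟨w.take n, List.length_take_le n w⟩).1 ++ w.drop n).take n
        = (q ⟨w.take n, List.length_take_le n w⟩).1 ∧
        ((q ⟨w.take n, List.length_take_le n w⟩).1 ++ w.drop n).drop n = w.drop n := by
      rcases le_total n w.length with h | h
      · have hl := len q w
        rw [min_eq_left h] at hl
        exact ⟨List.take_left' hl, List.drop_left' hl⟩
      · have hl := len q w
        rw [min_eq_right h] at hl
        rw [List.drop_eq_nil_of_le h, List.append_nil]
        exact ⟨List.take_of_length_le (hl.le.trans h), List.drop_eq_nil_of_le (hl.le.trans h)⟩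
    simp only [key.1, key.2, Subtype.coe_eta, hqr, List.take_append_drop]
  have edge : ∀ (q : FinTreeAut n) (v w : Word), Edge v w →
      Edge ((q ⟨v.take n, List.length_take_le n v⟩).1 ++ v.drop n)
        ((q ⟨w.take n, List.length_take_le n w⟩).1 ++ w.drop n) := fun q v w hvw => by
    obtain ⟨x, rfl⟩ := hvw
    rcases lt_or_ge v.length n with h | h
    · have h1 : (v ++ [x]).length ≤ n := by simp; omega
      rw [List.drop_eq_nil_of_le h.le, List.drop_eq_nil_of_le h1]
      simp only [List.append_nil, List.take_of_length_le h.le, List.take_of_length_le h1]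
      exact fin_map_edge q _ _ ⟨x, rfl⟩
    · simp only [List.take_append_of_le_length h, List.drop_append_of_le_length h]
      exact (edge_append _ _ _).2 ⟨x, rfl⟩
  { toFun := fun w => (p ⟨w.take n, List.length_take_le n w⟩).1 ++ w.drop n
    invFun := fun w => (p.symm ⟨w.take n, List.length_take_le n w⟩).1 ++ w.drop n
    left_inv := inv p p.symm p.symm_apply_apply
    right_inv := inv p.symm p p.apply_symm_apply
    map_rel_iff' := fun {a b} => ⟨fun h => by
      have h1 := edge p.symm _ _ h
      have ha := inv p p.symm p.symm_apply_apply a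
      have hb := inv p p.symm p.symm_apply_apply b
      have h2 := h1
      simp only [Equiv.coe_fn_mk] at h2
      rwa [ha, hb] at h2, edge p a b⟩ }

theorem res_extend {n : ℕ} (p : FinTreeAut n) : res n (extend p) = p := by
  ext v : 1
  apply Subtype.ext
  change (p ⟨v.1.take n, List.length_take_le n v.1⟩).1 ++ v.1.drop n = (p v).1
  simp only [List.drop_eq_nil_of_le v.2, List.append_nil, List.take_of_length_le v.2]

instance (d : ℕ) : Finite {w : Word // w.length ≤ d} :=
  (List.finite_length_le (Fin 2) d).to_subtype

instance (d : ℕ) : Finite (FinTreeAut d) :=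
  Finite.of_injective (fun p : FinTreeAut d => (p : _ → _)) DFunLike.coe_injective

theorem card_pos (n : ℕ) : 0 < Nat.card (FinTreeAut n) := Nat.card_pos

theorem card_mono {m n : ℕ} (h : m ≤ n) : Nat.card (FinTreeAut m) ≤ Nat.card (FinTreeAut n) :=
  Nat.card_le_card_of_surjective (finRes h) fun p => ⟨res n (extend p), by
    rw [finRes_res, res_extend]⟩

/-- The least `n` with `π_n(g) ≠ π_n(h)` (it is positive, and meaningful, when `g ≠ h`). -/
noncomputable def separationLevel (g h : TreeAut) : ℕ := sInf {n : ℕ | res n g ≠ res n h}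

theorem separationLevel_comm (g h : TreeAut) : separationLevel g h = separationLevel h g := by
  simp only [separationLevel, ne_comm]

theorem res_eq_of_lt {g h : TreeAut} {n : ℕ} (hn : n < separationLevel g h) :
    res n g = res n h := by
  by_contra hne
  exact Nat.notMem_of_lt_sInf hn hne

theorem res_separationLevel {g h : TreeAut} (hne : g ≠ h) :
    res (separationLevel g h) g ≠ res (separationLevel g h) h := by
  refine Nat.sInf_mem (s := {n : ℕ | res n g ≠ res n h}) ?_
  by_contra hemp
  apply hne
  ext w : 1
  have h1 : res w.length g = res w.length h := by
    by_contra h2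
    exact hemp ⟨_, h2⟩
  exact congrArg Subtype.val (DFunLike.congr_fun h1 ⟨w, le_rfl⟩)

theorem min_separationLevel_le {g h k : TreeAut} (hgk : g ≠ k) :
    min (separationLevel g h) (separationLevel h k) ≤ separationLevel g k := by
  by_contra hlt
  rw [not_le, lt_min_iff] at hlt
  exact res_separationLevel hgk ((res_eq_of_lt hlt.1).trans (res_eq_of_lt hlt.2))

open Classical in
/-- The profinite distance given by the filtration of `G` by the level stabilizers: `d(g, g) = 0`,
and for `g ≠ h` one has `d(g, h) = 1 / |G(n)|` for the largest `n` with `π_n(g) = π_n(h)`. -/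
noncomputable def profiniteDist (g h : TreeAut) : ℝ :=
  if g = h then 0 else 1 / (Nat.card (FinTreeAut (separationLevel g h - 1)) : ℝ)

theorem profiniteDist_nonneg (g h : TreeAut) : 0 ≤ profiniteDist g h := by
  unfold profiniteDist
  split_ifs <;> positivity

theorem profiniteDist_le {g h : TreeAut} {n : ℕ} (hn : n ≤ separationLevel g h) :
    profiniteDist g h ≤ 1 / (Nat.card (FinTreeAut (n - 1)) : ℝ) := by
  unfold profiniteDist
  split_ifs with heq
  · positivity
  · apply one_div_le_one_div_of_le
    · exact_mod_cast card_pos _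
    · exact_mod_cast card_mono (by omega)

theorem profiniteDist_triangle (g h k : TreeAut) :
    profiniteDist g k ≤ profiniteDist g h + profiniteDist h k := by
  by_cases hgk : g = k
  · rw [profiniteDist, if_pos hgk]
    exact add_nonneg (profiniteDist_nonneg _ _) (profiniteDist_nonneg _ _)
  by_cases hgh : g = h
  · subst hgh
    linarith [profiniteDist_nonneg g g]
  by_cases hhk : h = k
  · subst hhk
    linarith [profiniteDist_nonneg h h]
  rcases min_le_iff.1 (min_separationLevel_le (h := h) hgk) with h1 | h1
  · have h2 : profiniteDist g k ≤ profiniteDist g h := by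
      conv_rhs => rw [profiniteDist, if_neg hgh]
      exact profiniteDist_le h1
    linarith [profiniteDist_nonneg h k]
  · have h2 : profiniteDist g k ≤ profiniteDist h k := by
      conv_rhs => rw [profiniteDist, if_neg hhk]
      exact profiniteDist_le h1
    linarith [profiniteDist_nonneg g h]

/-- The profinite metric on `Aut(X^*)`. -/
noncomputable instance : MetricSpace TreeAut where
  dist := profiniteDist
  dist_self g := by simp [profiniteDist]
  dist_comm g h := by
    by_cases heq : g = h
    · rw [heq]
    · simp only [profiniteDist, if_neg heq, if_neg (Ne.symm heq), separationLevel_comm g h]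
  dist_triangle := profiniteDist_triangle
  eq_of_dist_eq_zero {g h} h0 := by
    by_contra hne
    change profiniteDist g h = 0 at h0
    rw [profiniteDist, if_neg hne] at h0
    have : (0 : ℝ) < Nat.card (FinTreeAut (separationLevel g h - 1)) := by
      exact_mod_cast card_pos _
    exact absurd h0 (by positivity)

end BinTree

namespace BinTree

/-! Write `d = n + 2`, let `A` be the preimage in `G` of the pattern group, and let `L = kerLabels A
(n + 1)`: the bottom labels of the patterns that are trivial above them, a vector space over the
field with two elements. An element of `H` is coded, up to finitely many initial choices, by a free
choice of a vector of `L` at every word, so `Hdim(H) = dim L / 2 ^ (n + 1)` (`dimH_le_finrank_div`,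
`finrank_div_le_dimH`). The hypothesis thus says that `L` has codimension two.

Cutting vectors into halves embeds `L` into two copies of `kerLabels A n`, which therefore has
codimension at most one. If it were one, the embedding would be bijective and patterns of size `n +
1` would define `H` (`treeSection_mem_of_finrank_eq`), against minimality of `d`. So the kernels
above the bottom level are full, `A` maps onto `G(n + 1)`, and `L` is invariant under all tree
automorphisms. This forces `L` to be the space of vectors whose sum over each half of the level is
zero (`eq_ker_halfSums`).

Hence `A` is the zero set of a function `D : G → (C_2)^2`, the half sums of the discrepancy between
`g` and an element of `A` with the same action up to level `n + 1`. It satisfies `D (g * s) = D g +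
D s` when `s` fixes the first level, and depends on finitely many labels. Such a function is
additive in portraits (`additive_of_map_mul`), so `A`, and with it `H`, has additive portraits. -/

/-! ### Portraits -/

/-- The action of a label of `C_2` on the letters. -/
def move (c : ZMod 2) (x : Fin 2) : Fin 2 := if c = 0 then x else 1 - x

theorem move_zero (x : Fin 2) : move 0 x = x := rfl

theorem move_move (c c' : ZMod 2) (x : Fin 2) : move c (move c' x) = move (c + c') x := by
  revert c c' x
  decide

theorem move_self (c : ZMod 2) (x : Fin 2) : move c (move c x) = x := by
  revert c x
  decide

theorem move_left_injective {c c' : ZMod 2} {x : Fin 2} (h : move c x = move c' x) : c = c' := by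
  revert c c' x
  decide

theorem zmod_two_eq_one {c : ZMod 2} (h : c ≠ 0) : c = 1 := by
  revert c
  decide

theorem treeSection_singleton (g : TreeAut) (w : Word) (x : Fin 2) :
    treeSection g w [x] = [move (portrait g w) x] := by
  have h1 : ∀ y : Fin 2, ∃ z, treeSection g w [y] = [z] := fun y =>
    List.length_eq_one_iff.1 (length_map (treeSection g w) [y])
  obtain ⟨a, ha⟩ := h1 0
  obtain ⟨b, hb⟩ := h1 1
  have hab : a ≠ b := by
    rintro rfl
    have := (treeSection g w).injective (ha.trans hb.symm)
    simp at this
  have hp : portrait g w = if a = 1 then 1 else 0 := by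
    simp [portrait, ha]
  rw [hp]
  clear hp h1
  fin_cases x
  · refine ha.trans ?_
    congr 1
    clear ha hb hab
    revert a
    decide
  · refine hb.trans ?_
    congr 1
    clear ha hb
    revert a b
    decide

theorem map_concat_eq (g : TreeAut) (w : Word) (x : Fin 2) :
    g (w ++ [x]) = g w ++ [move (portrait g w) x] := by
  rw [treeSection_spec, treeSection_singleton]

theorem map_cons (g : TreeAut) (x : Fin 2) (w : Word) :
    g (x :: w) = move (portrait g []) x :: treeSection g [x] w := by
  have h := map_concat_eq g [] x
  rw [map_nil, List.nil_append, List.nil_append] at h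
  have h2 := treeSection_spec g [x] w
  rwa [h] at h2

theorem portrait_eq_of_map {g : TreeAut} {w : Word} {x : Fin 2} {c : ZMod 2}
    (h : g (w ++ [x]) = g w ++ [move c x]) : portrait g w = c := by
  rw [map_concat_eq] at h
  have h2 := List.append_cancel_left h
  exact move_left_injective (List.singleton_injective h2)

theorem treeSection_treeSection (g : TreeAut) (u v : Word) :
    treeSection (treeSection g u) v = treeSection g (u ++ v) := by
  ext w : 1
  apply List.append_cancel_left (as := g (u ++ v))
  rw [← treeSection_spec, treeSection_spec g u v, List.append_assoc, ← treeSection_spec,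
    ← treeSection_spec, List.append_assoc]

theorem portrait_treeSection (g : TreeAut) (u v : Word) :
    portrait (treeSection g u) v = portrait g (u ++ v) := by
  simp only [portrait, treeSection_treeSection]

theorem portrait_mul (g h : TreeAut) (w : Word) :
    portrait (g * h) w = portrait g (h w) + portrait h w := by
  apply portrait_eq_of_map (x := 0)
  rw [RelIso.mul_apply, map_concat_eq, map_concat_eq, move_move, RelIso.mul_apply]

theorem portrait_one (w : Word) : portrait 1 w = 0 :=
  portrait_eq_of_map (x := 0) rfl

theorem res_eq_iff_map {n : ℕ} {g h : TreeAut} :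
    res n g = res n h ↔ ∀ w : Word, w.length ≤ n → g w = h w := by
  constructor
  · intro heq w hw
    exact congrArg Subtype.val (DFunLike.congr_fun heq ⟨w, hw⟩)
  · intro heq
    ext v : 1
    exact Subtype.ext (heq v.1 v.2)

theorem res_eq_one_iff_map {n : ℕ} {g : TreeAut} :
    res n g = 1 ↔ ∀ w : Word, w.length ≤ n → g w = w := by
  rw [← map_one (res n), res_eq_iff_map]
  rfl

/-- A label at `w` governs the letter after `w`, so the action up to level `n` is the same data as
the labels strictly above level `n`. -/
theorem res_eq_iff {n : ℕ} {g h : TreeAut} :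
    res n g = res n h ↔ ∀ w : Word, w.length < n → portrait g w = portrait h w := by
  rw [res_eq_iff_map]
  constructor
  · intro heq w hw
    apply portrait_eq_of_map (x := 0)
    rw [heq _ (by simpa using hw), map_concat_eq, heq w hw.le]
  · intro heq w
    induction w using List.reverseRecOn with
    | nil => simp [map_nil]
    | append_singleton w x ih =>
      intro hw
      have hw' : w.length < n := by simpa using hw
      rw [map_concat_eq, map_concat_eq, ih hw'.le, heq w hw']

theorem res_eq_one_iff {n : ℕ} {g : TreeAut} :
    res n g = 1 ↔ ∀ w : Word, w.length < n → portrait g w = 0 := by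
  rw [← map_one (res n), res_eq_iff]
  simp only [portrait_one]

theorem ext_portrait {g h : TreeAut} (heq : ∀ w, portrait g w = portrait h w) : g = h := by
  ext w : 1
  exact res_eq_iff_map.1 (res_eq_iff.2 fun w _ => heq w) w le_rfl

theorem res_mono {n m : ℕ} (hnm : m ≤ n) {g h : TreeAut} (heq : res n g = res n h) :
    res m g = res m h :=
  res_eq_iff.2 fun w hw => res_eq_iff.1 heq w (hw.trans_le hnm)

theorem res_treeSection {n m : ℕ} {g h : TreeAut} {u : Word} (hu : u.length + m ≤ n)
    (heq : res n g = res n h) : res m (treeSection g u) = res m (treeSection h u) :=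
  res_eq_iff.2 fun w hw => by
    rw [portrait_treeSection, portrait_treeSection]
    exact res_eq_iff.1 heq _ (by simp; omega)

/-- The twist in `portrait_mul` disappears because `h` fixes `w`; this makes kernels into vector
spaces. -/
theorem portrait_mul_of_res {n : ℕ} {g h : TreeAut} (hh : res n h = 1) {w : Word}
    (hw : w.length ≤ n) : portrait (g * h) w = portrait g w + portrait h w := by
  rw [portrait_mul, res_eq_one_iff_map.1 hh w hw]

/-! ### The automorphism with a given portrait -/

/-- The action on words of the portrait `f`. -/
def act : (Word → ZMod 2) → Word → Word
  | _, [] => []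
  | f, x :: w => move (f []) x :: act (fun v => f (x :: v)) w

/-- The inverse action on words of the portrait `f`. -/
def actInv : (Word → ZMod 2) → Word → Word
  | _, [] => []
  | f, y :: w => move (f []) y :: actInv (fun v => f (move (f []) y :: v)) w

theorem actInv_act (f : Word → ZMod 2) (w : Word) : actInv f (act f w) = w := by
  induction w generalizing f with
  | nil => rfl
  | cons x w ih => simp only [act, actInv, move_self, ih]

theorem act_actInv (f : Word → ZMod 2) (w : Word) : act f (actInv f w) = w := by
  induction w generalizing f with
  | nil => rfl
  | cons x w ih => simp only [act, actInv, move_self, ih]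

theorem act_concat (f : Word → ZMod 2) (w : Word) (x : Fin 2) :
    act f (w ++ [x]) = act f w ++ [move (f w) x] := by
  induction w generalizing f with
  | nil => rfl
  | cons y w ih => simp only [List.cons_append, act, ih]

/-- The automorphism with portrait `f`. -/
def ofPortrait (f : Word → ZMod 2) : TreeAut where
  toFun := act f
  invFun := actInv f
  left_inv := actInv_act f
  right_inv := act_actInv f
  map_rel_iff' {a b} := by
    constructor
    · rintro ⟨y, hy⟩
      refine ⟨move (f a) y, ?_⟩
      have h : act f b = act f (a ++ [move (f a) y]) := by
        rw [act_concat, move_self]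
        exact hy
      rw [← actInv_act f b, h, actInv_act]
    · rintro ⟨x, rfl⟩
      exact ⟨_, act_concat f a x⟩

theorem portrait_ofPortrait (f : Word → ZMod 2) : portrait (ofPortrait f) = f :=
  funext fun w => portrait_eq_of_map (x := 0) (act_concat f w 0)

/-! ### Counting -/

/-- The position of a word in the enumeration of the words by their bijective binary value. -/
def wordIndex : Word → ℕ
  | [] => 0
  | x :: w => 2 * wordIndex w + 1 + x

/-- The word at a given position. -/
def wordAt : ℕ → Word
  | 0 => []
  | j + 1 => ⟨j % 2, Nat.mod_lt _ two_pos⟩ :: wordAt (j / 2)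
decreasing_by omega

theorem wordIndex_wordAt (j : ℕ) : wordIndex (wordAt j) = j := by
  induction j using Nat.strong_induction_on with
  | _ j ih =>
    cases j with
    | zero => simp [wordAt, wordIndex]
    | succ j =>
      rw [wordAt, wordIndex, ih _ (by omega)]
      simp only
      omega

theorem wordAt_wordIndex (w : Word) : wordAt (wordIndex w) = w := by
  induction w with
  | nil => simp [wordAt, wordIndex]
  | cons x w ih =>
    have hx : wordIndex (x :: w) = (2 * wordIndex w + x) + 1 := by
      rw [wordIndex]
      omega
    rw [hx, wordAt]
    have h1 : (2 * wordIndex w + x) / 2 = wordIndex w := by omega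
    have h2 : (2 * wordIndex w + x) % 2 = x := by omega
    rw [h1, ih]
    congr 1
    exact Fin.ext h2

/-- Shorter words come first in the enumeration, so data agreeing on all short words agree on an
initial run of digits, as needed in `finrank_div_le_dimH`. -/
theorem wordIndex_lt_iff (w : Word) (n : ℕ) : wordIndex w < 2 ^ n - 1 ↔ w.length < n := by
  induction w generalizing n with
  | nil =>
    cases n with
    | zero => simp [wordIndex]
    | succ n =>
      have : 0 < 2 ^ n := by positivity
      simp only [wordIndex, List.length_nil, pow_succ]
      omega
  | cons x w ih =>
    cases n with
    | zero => simp
    | succ n =>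
      have := ih n
      have h2 : 0 < 2 ^ n := by positivity
      simp only [wordIndex, List.length_cons, pow_succ]
      omega

theorem length_wordAt_lt {j n : ℕ} (hj : j < 2 ^ n - 1) : (wordAt j).length < n := by
  rw [← wordIndex_lt_iff, wordIndex_wordAt]
  exact hj

/-- The words of length less than `n` are counted by `2 ^ n - 1`. -/
def shortWordEquiv (n : ℕ) : {w : Word // w.length < n} ≃ Fin (2 ^ n - 1) where
  toFun w := ⟨wordIndex w.1, (wordIndex_lt_iff _ _).2 w.2⟩
  invFun j := ⟨wordAt j, length_wordAt_lt j.2⟩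
  left_inv w := Subtype.ext (wordAt_wordIndex w.1)
  right_inv j := Fin.ext (wordIndex_wordAt j)

instance (n : ℕ) : Fintype {w : Word // w.length < n} := Fintype.ofEquiv _ (shortWordEquiv n).symm

theorem card_shortWord (n : ℕ) : Fintype.card {w : Word // w.length < n} = 2 ^ n - 1 := by
  rw [Fintype.card_congr (shortWordEquiv n), Fintype.card_fin]

/-- The portrait of a finite automorphism. -/
noncomputable def finPortraitEquiv (n : ℕ) :
    FinTreeAut n ≃ ({w : Word // w.length < n} → ZMod 2) :=
  Equiv.ofBijective (fun p w => portrait (extend p) w.1) <| by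
    constructor
    · intro p q hpq
      rw [← res_extend p, ← res_extend q, res_eq_iff]
      exact fun w hw => congrFun hpq ⟨w, hw⟩
    · intro f
      refine ⟨res n (ofPortrait fun w => if hw : w.length < n then f ⟨w, hw⟩ else 0), ?_⟩
      funext w
      have h := res_eq_iff.1 (res_extend (res n (ofPortrait fun w =>
        if hw : w.length < n then f ⟨w, hw⟩ else 0))) w.1 w.2
      refine h.trans ?_
      rw [portrait_ofPortrait, dif_pos w.2]

theorem card_finTreeAut (n : ℕ) : Nat.card (FinTreeAut n) = 2 ^ (2 ^ n - 1) := by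
  rw [Nat.card_congr (finPortraitEquiv n), Nat.card_eq_fintype_card, Fintype.card_fun,
    card_shortWord, ZMod.card]

/-! ### Labels on a level -/

/-- The words of length `n`. -/
abbrev Level (n : ℕ) := List.Vector (Fin 2) n

/-- The labels of `g` on the words of length `n`. -/
def labels (n : ℕ) (g : TreeAut) : Level n → ZMod 2 := fun v => portrait g v.1

theorem labels_mul {n : ℕ} (g : TreeAut) {h : TreeAut} (hh : res n h = 1) :
    labels n (g * h) = labels n g + labels n h :=
  funext fun v => portrait_mul_of_res hh v.2.le

theorem labels_one (n : ℕ) : labels n 1 = 0 := funext fun v => portrait_one v.1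

/-- The labels on level `n` of the elements of `A` that act trivially on level `n`. -/
def kerLabels (A : Subgroup TreeAut) (n : ℕ) : Submodule (ZMod 2) (Level n → ZMod 2) :=
  AddSubgroup.toZModSubmodule 2
    { carrier := {v | ∃ g ∈ A, res n g = 1 ∧ labels n g = v}
      zero_mem' := ⟨1, A.one_mem, map_one _, labels_one n⟩
      add_mem' := by
        rintro _ _ ⟨g, hg, hg1, rfl⟩ ⟨h, hh, hh1, rfl⟩
        exact ⟨g * h, A.mul_mem hg hh, by rw [map_mul, hg1, hh1, one_mul], labels_mul g hh1⟩
      neg_mem' := by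
        rintro _ ⟨g, hg, hg1, rfl⟩
        refine ⟨g, hg, hg1, funext fun v => ?_⟩
        rw [Pi.neg_apply, ZMod.neg_eq_self_mod_two] }

theorem mem_kerLabels {A : Subgroup TreeAut} {n : ℕ} {v : Level n → ZMod 2} :
    v ∈ kerLabels A n ↔ ∃ g ∈ A, res n g = 1 ∧ labels n g = v := Iff.rfl

theorem exists_labels_eq_add {A : Subgroup TreeAut} {n : ℕ} {a b : TreeAut} (ha : a ∈ A)
    (hb : b ∈ A) (hab : res n a = res n b) : ∃ l ∈ kerLabels A n, labels n b = labels n a + l := by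
  have h1 : res n (a⁻¹ * b) = 1 := by rw [map_mul, map_inv, hab, inv_mul_cancel]
  refine ⟨_, ⟨a⁻¹ * b, A.mul_mem (A.inv_mem ha) hb, h1, rfl⟩, ?_⟩
  rw [← labels_mul a h1, mul_inv_cancel_left]

/-- Since `A` sees only the labels on levels up to `n`, an element trivial above level `n` is judged
by its labels on level `n` alone. -/
theorem mem_of_labels_mem {A : Subgroup TreeAut} {n : ℕ}
    (hA : ∀ g h, res (n + 1) g = res (n + 1) h → g ∈ A → h ∈ A) {g : TreeAut} (hg : res n g = 1)
    (hl : labels n g ∈ kerLabels A n) : g ∈ A := by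
  obtain ⟨a, ha, ha1, hal⟩ := hl
  refine hA a g (res_eq_iff.2 fun w hw => ?_) ha
  rcases (Nat.lt_succ_iff.1 hw).lt_or_eq with h | h
  · rw [res_eq_one_iff.1 hg w h, res_eq_one_iff.1 ha1 w h]
  · exact congrFun hal ⟨w, h⟩

/-! ### Coordinates on a finitely constrained group -/

section Coordinates

variable {A : Subgroup TreeAut} {n : ℕ} (Λ : (Level n → ZMod 2) →ₗ[ZMod 2] kerLabels A n)

/-- The coordinates of `g`, one for each word `u`, given by a projection `Λ` of the level `n` of the
section `g_u`. -/
def blockBits (g : TreeAut) (u : Word) : kerLabels A n := Λ (labels n (treeSection g u))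

/-- Induction on levels: if `g` and `h` agree up to level `n + m`, their sections at a word of
length `m` lie in `A` and agree up to level `n`, so their next labels differ by a kernel vector,
which `Λ` detects. -/
theorem res_eq_of_blockBits (hΛ : ∀ v : kerLabels A n, Λ v = v) (m : ℕ) {g h : TreeAut}
    (hg : ∀ w, treeSection g w ∈ A) (hh : ∀ w, treeSection h w ∈ A) (h0 : res n g = res n h)
    (hb : ∀ u : Word, u.length < m → blockBits Λ g u = blockBits Λ h u) :
    res (n + m) g = res (n + m) h := by
  induction m with
  | zero => exact h0
  | succ m ih =>
    have ih' := ih fun u hu => hb u (hu.trans (Nat.lt_succ_self m))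
    refine res_eq_iff.2 fun w hw => ?_
    rcases (show w.length ≤ n + m by omega).lt_or_eq with hlt | heq
    · exact res_eq_iff.1 ih' w hlt
    · have hu : (w.take m).length = m := by simp; omega
      have hv : (w.drop m).length = n := by simp; omega
      obtain ⟨l, hl, hgl⟩ := exists_labels_eq_add (hg (w.take m)) (hh (w.take m))
        (res_treeSection (n := n + m) (m := n) (by omega) ih')
      have hz : l = 0 := by
        have h1 := hb (w.take m) (by omega)
        simp only [blockBits] at h1
        rw [hgl, map_add, hΛ ⟨l, hl⟩, left_eq_add] at h1
        exact congrArg Subtype.val h1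
      rw [hz, add_zero] at hgl
      have h2 := congrFun hgl ⟨w.drop m, hv⟩
      simp only [labels, portrait_treeSection, List.take_append_drop] at h2
      exact h2.symm

theorem blockBits_eq_of_res {N : ℕ} {g h : TreeAut} (hgh : res N g = res N h) {u : Word}
    (hu : u.length + n < N) : blockBits Λ g u = blockBits Λ h u := by
  have h1 := res_treeSection (m := n + 1) (u := u) (by omega) hgh
  have h2 : labels n (treeSection g u) = labels n (treeSection h u) :=
    funext fun v => res_eq_iff.1 h1 v.1 (by rw [v.2]; omega)
  rw [blockBits, blockBits, h2]

/-- Essentiality extends the section to a pattern; a kernel element corrects its coordinate to `c`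
without changing the action up to level `n`. -/
theorem exists_next_state (hΛ : ∀ v : kerLabels A n, Λ v = v)
    (hess : ∀ p ∈ A, ∀ i : Fin 2, ∃ q ∈ A, res n q = res n (treeSection p [i])) (p : A)
    (i : Fin 2) (c : kerLabels A n) :
    ∃ q : A, res n q = res n (treeSection (p : TreeAut) [i]) ∧ Λ (labels n q) = c := by
  obtain ⟨q, hq, hqp⟩ := hess p p.2 i
  obtain ⟨l, hl, hl1, hlc⟩ := mem_kerLabels.1 (c - Λ (labels n q)).2
  refine ⟨⟨q * l, A.mul_mem hq hl⟩, ?_, ?_⟩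
  · simp only [map_mul, hl1, mul_one, hqp]
  · simp only
    rw [labels_mul q hl1, hlc, map_add, hΛ, add_sub_cancel]

/-- The coordinates are free: patterns are chosen recursively down the tree, each overlapping its
parent and realizing its prescribed coordinate, and their root labels form the portrait of `h`. -/
theorem exists_blockBits_eq (hΛ : ∀ v : kerLabels A n, Λ v = v)
    (hA : ∀ g h, res (n + 1) g = res (n + 1) h → g ∈ A → h ∈ A)
    (hess : ∀ p ∈ A, ∀ i : Fin 2, ∃ q ∈ A, res n q = res n (treeSection p [i]))
    (b : Word → kerLabels A n) :
    ∃ h : TreeAut, (∀ w, treeSection h w ∈ A) ∧ blockBits Λ h = b := by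
  choose step hstep hstepb using exists_next_state Λ hΛ hess
  obtain ⟨s, hs, -, hsb⟩ := mem_kerLabels.1 (b []).2
  -- States are indexed by reversed words, so that recursion on lists appends a letter at the end of
  -- the word.
  let state : Word → A := fun r =>
    List.rec ⟨s, hs⟩ (fun i r p => step p i (b (r.reverse ++ [i]))) r
  have hstate : ∀ (r : Word), Λ (labels n (state r).1) = b r.reverse := by
    intro r
    cases r with
    | nil => exact (congrArg Λ hsb).trans (hΛ _)
    | cons i r => rw [List.reverse_cons]; exact hstepb _ _ _
  -- The overlaps make the state at a word predict the root labels of its descendants down to depth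
  -- `n`.
  have hport : ∀ (v r : Word), v.length ≤ n →
      portrait (state r).1 v = portrait (state (v.reverse ++ r)).1 [] := by
    intro v
    induction v with
    | nil => intro r _; rfl
    | cons i v ih =>
      intro r hv
      have hv' : v.length < n := by simpa using hv
      rw [List.reverse_cons, List.append_assoc, List.singleton_append, ← ih _ hv'.le]
      have h1 := res_eq_iff.1 (hstep (state r) i (b (r.reverse ++ [i]))) v hv'
      rw [portrait_treeSection] at h1
      exact h1.symm
  let h : TreeAut := ofPortrait fun w => portrait (state w.reverse).1 []
  have hsec : ∀ u v : Word, v.length ≤ n →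
      portrait (treeSection h u) v = portrait (state u.reverse).1 v := by
    intro u v hv
    rw [portrait_treeSection, portrait_ofPortrait, List.reverse_append, hport v _ hv]
  refine ⟨h, fun w => ?_, funext fun u => ?_⟩
  · exact hA _ _ (res_eq_iff.2 fun v hv => (hsec w v (Nat.lt_succ_iff.1 hv)).symm)
      (state w.reverse).2
  · have h1 : labels n (treeSection h u) = labels n (state u.reverse).1 :=
      funext fun v => hsec u v.1 v.2.le
    rw [blockBits, h1, hstate, List.reverse_reverse]

end Coordinates

/-! ### The Hausdorff dimension -/

theorem dist_le_of_res {N : ℕ} {g h : TreeAut} (hgh : res N g = res N h) :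
    dist g h ≤ ((2 : ℝ) ^ (2 ^ N - 1))⁻¹ := by
  by_cases hne : g = h
  · rw [hne, dist_self]
    positivity
  · have hN : N + 1 ≤ separationLevel g h := by
      by_contra hlt
      exact res_separationLevel hne (res_mono (by omega) hgh)
    have h1 : profiniteDist g h ≤ _ := profiniteDist_le hN
    rw [Nat.add_sub_cancel, card_finTreeAut, one_div] at h1
    exact_mod_cast h1

theorem exists_res_eq_dist_eq {g h : TreeAut} (hne : g ≠ h) :
    ∃ N : ℕ, res N g = res N h ∧ dist g h = ((2 : ℝ) ^ (2 ^ N - 1))⁻¹ := by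
  have hpos : separationLevel g h ≠ 0 := by
    intro h0
    have h1 := res_separationLevel hne
    rw [h0] at h1
    exact h1 (res_eq_iff.2 fun w hw => absurd hw (Nat.not_lt_zero _))
  refine ⟨separationLevel g h - 1, res_eq_of_lt (by omega), ?_⟩
  change profiniteDist g h = _
  rw [profiniteDist, if_neg hne, card_finTreeAut, one_div]
  norm_cast

theorem inv_pow_rpow_eq (N k n : ℕ) : (((2 : ℝ) ^ (2 ^ N - 1))⁻¹) ^ ((k : ℝ) / 2 ^ n) =
    (2 : ℝ) ^ (-((2 ^ N - 1) * ((k : ℝ) / 2 ^ n))) := by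
  have h1 : ((2 : ℝ) ^ (2 ^ N - 1))⁻¹ = (2 : ℝ) ^ (-(2 ^ N - 1 : ℝ)) := by
    rw [Real.rpow_neg two_pos.le, ← Real.rpow_natCast, Nat.cast_sub Nat.one_le_two_pow]
    norm_num
  rw [h1, ← Real.rpow_mul two_pos.le, neg_mul]

theorem pow_pow_eq_rpow (k m : ℕ) :
    ((2 : ℝ) ^ k) ^ (2 ^ m - 1) = (2 : ℝ) ^ ((k : ℝ) * (2 ^ m - 1)) := by
  rw [← pow_mul, ← Real.rpow_natCast, Nat.cast_mul, Nat.cast_sub Nat.one_le_two_pow]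
  norm_num

section Dimension

open Module

variable {A : Subgroup TreeAut} {n : ℕ}

theorem card_kerLabels (A : Subgroup TreeAut) (n : ℕ) :
    Nat.card (kerLabels A n) = 2 ^ finrank (ZMod 2) (kerLabels A n) := by
  rw [Module.natCard_eq_pow_finrank (K := ZMod 2), Nat.card_zmod]

theorem exists_projection (A : Subgroup TreeAut) (n : ℕ) :
    ∃ Λ : (Level n → ZMod 2) →ₗ[ZMod 2] kerLabels A n, ∀ v : kerLabels A n, Λ v = v := by
  obtain ⟨Λ, hΛ⟩ := (kerLabels A n).subtype.exists_leftInverse_of_injective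
    (Submodule.ker_subtype _)
  exact ⟨Λ, fun v => LinearMap.congr_fun hΛ v⟩

-- Cover by the sets on which `res n` and the coordinates at words shorter than `m` are fixed. The
-- number of sets times the diameter bound to the power `k / 2 ^ n` stays below `|G(n)|`, so the
-- Hausdorff measure in that dimension is finite.
open MeasureTheory Measure in
theorem dimH_le_finrank_div :
    dimH {g : TreeAut | ∀ w, treeSection g w ∈ A} ≤
      ((finrank (ZMod 2) (kerLabels A n) / 2 ^ n : NNReal) : ENNReal) := by
  obtain ⟨Λ, hΛ⟩ := exists_projection A n
  set k := finrank (ZMod 2) (kerLabels A n) with hk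
  borelize TreeAut
  apply dimH_le_of_hausdorffMeasure_ne_top
  have : Fintype (FinTreeAut n) := Fintype.ofFinite _
  have : Fintype (kerLabels A n) := Fintype.ofFinite _
  let t : ∀ m : ℕ, FinTreeAut n × ({w : Word // w.length < m} → kerLabels A n) → Set TreeAut :=
    fun m c => {g | (∀ w, treeSection g w ∈ A) ∧ res n g = c.1 ∧ ∀ u, blockBits Λ g u.1 = c.2 u}
  have hdiam : ∀ m c, Metric.ediam (t m c) ≤ ENNReal.ofReal ((2 : ℝ) ^ (2 ^ (n + m) - 1))⁻¹ := by
    intro m c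
    refine Metric.ediam_le fun g hg h hh => ?_
    rw [edist_dist]
    apply ENNReal.ofReal_le_ofReal
    apply dist_le_of_res
    refine res_eq_of_blockBits Λ hΛ m hg.1 hh.1 (hg.2.1.trans hh.2.1.symm) fun u hu => ?_
    rw [hg.2.2 ⟨u, hu⟩, hh.2.2 ⟨u, hu⟩]
  have hbound := hausdorffMeasure_le_liminf_sum (X := TreeAut)
    ((k / 2 ^ n : NNReal) : ℝ) {g : TreeAut | ∀ w, treeSection g w ∈ A} (l := Filter.atTop)
    (fun m : ℕ => ENNReal.ofReal ((2 : ℝ) ^ (2 ^ (n + m) - 1))⁻¹) ?_ t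
    (Filter.Eventually.of_forall hdiam)
    (Filter.Eventually.of_forall fun m g hg =>
      Set.mem_iUnion.2 ⟨(res n g, fun u => blockBits Λ g u.1), hg, rfl, fun _ => rfl⟩)
  · refine ne_top_of_le_ne_top (b := ENNReal.ofReal (Fintype.card (FinTreeAut n)))
      ENNReal.ofReal_ne_top (hbound.trans ?_)
    refine Filter.liminf_le_of_le (by isBoundedDefault) fun b hb => ?_
    obtain ⟨m, hm⟩ := hb.exists
    refine hm.trans ?_
    calc ∑ c, Metric.ediam (t m c) ^ ((k / 2 ^ n : NNReal) : ℝ)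
        ≤ ∑ c : FinTreeAut n × ({w : Word // w.length < m} → kerLabels A n),
          ENNReal.ofReal (((2 : ℝ) ^ (2 ^ (n + m) - 1))⁻¹ ^ ((k : ℝ) / 2 ^ n)) := by
          refine Finset.sum_le_sum fun c _ => ?_
          rw [← ENNReal.ofReal_rpow_of_nonneg (by positivity) (by positivity)]
          have : ((k / 2 ^ n : NNReal) : ℝ) = (k : ℝ) / 2 ^ n := by simp
          rw [this]
          exact ENNReal.rpow_le_rpow (hdiam m c) (by positivity)
      _ = ENNReal.ofReal (Fintype.card (FinTreeAut n) * (((2 : ℝ) ^ k) ^ (2 ^ m - 1) *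
          ((2 : ℝ) ^ (2 ^ (n + m) - 1))⁻¹ ^ ((k : ℝ) / 2 ^ n))) := by
          rw [Finset.sum_const, Finset.card_univ, nsmul_eq_mul, Fintype.card_prod,
            Fintype.card_fun, card_shortWord, ← Nat.card_eq_fintype_card (α := kerLabels A n),
            card_kerLabels, ← hk, ← mul_assoc, ENNReal.ofReal_mul (by positivity)]
          congr 1
          rw [← ENNReal.ofReal_natCast]
          push_cast
          rfl
      _ ≤ ENNReal.ofReal (Fintype.card (FinTreeAut n)) := by
          apply ENNReal.ofReal_le_ofReal
          refine mul_le_of_le_one_right (by positivity) ?_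
          -- The total exponent of 2 is `k * (2 ^ m - 1) - (2 ^ (n + m) - 1) * k / 2 ^ n = k / 2 ^ n
          -- - k ≤ 0`.
          rw [inv_pow_rpow_eq, pow_pow_eq_rpow, ← Real.rpow_add two_pos]
          apply Real.rpow_le_one_of_one_le_of_nonpos one_le_two
          have h1 : (2 : ℝ) ^ (n + m) * (k / 2 ^ n) = k * 2 ^ m := by
            rw [pow_add]
            field_simp
          have h2 : (k : ℝ) / 2 ^ n ≤ k := div_le_self (by positivity) (one_le_pow₀ one_le_two)
          rw [sub_mul, h1]
          linarith
  -- Side condition of the covering bound: the diameters tend to zero.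
  · rw [← ENNReal.ofReal_zero]
    refine ENNReal.tendsto_ofReal ?_
    refine tendsto_inv_atTop_zero.comp ?_
    refine (tendsto_pow_atTop_atTop_of_one_lt one_lt_two).comp ?_
    refine Filter.tendsto_atTop_mono (fun m => ?_) Filter.tendsto_id
    have h1 : m < 2 ^ m := Nat.lt_two_pow_self
    have h2 : 2 ^ m ≤ 2 ^ (n + m) := Nat.pow_le_pow_right two_pos (Nat.le_add_left m n)
    simp only [id]
    omega

/-- Reading the coordinates as digits in base `2 ^ k` gives a Hölder map of exponent `k / 2 ^ n`
onto a set containing `[0, 1]`, and such a map raises dimension at most by the factor `2 ^ n / k`.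
-/
theorem finrank_div_le_dimH (hA : ∀ g h, res (n + 1) g = res (n + 1) h → g ∈ A → h ∈ A)
    (hess : ∀ p ∈ A, ∀ i : Fin 2, ∃ q ∈ A, res n q = res n (treeSection p [i])) :
    ((finrank (ZMod 2) (kerLabels A n) / 2 ^ n : NNReal) : ENNReal) ≤
      dimH {g : TreeAut | ∀ w, treeSection g w ∈ A} := by
  obtain ⟨Λ, hΛ⟩ := exists_projection A n
  set k := finrank (ZMod 2) (kerLabels A n) with hk
  -- The digit map needs a base larger than 1 and a positive exponent.
  rcases Nat.eq_zero_or_pos k with h0 | hpos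
  · simp [h0]
  set r : NNReal := k / 2 ^ n with hr
  have hrr : (r : ℝ) = (k : ℝ) / 2 ^ n := by simp [hr]
  have hrpos : 0 < r := by positivity
  let e : kerLabels A n ≃ Fin (2 ^ k) := Finite.equivFinOfCardEq (card_kerLabels A n)
  let f : TreeAut → ℝ := fun g => Real.ofDigits fun j => e (blockBits Λ g (wordAt j))
  have hf : HolderOnWith (2 ^ k) r f {g : TreeAut | ∀ w, treeSection g w ∈ A} := by
    intro g _ h _
    by_cases hne : g = h
    · simp [hne]
    obtain ⟨N, hN, hd⟩ := exists_res_eq_dist_eq hne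
    have h1 : |f g - f h| ≤ (((2 ^ k : ℕ) : ℝ) ^ (2 ^ (N - n) - 1))⁻¹ := by
      refine Real.abs_ofDigits_sub_ofDigits_le fun j hj => ?_
      have := length_wordAt_lt hj
      rw [blockBits_eq_of_res Λ hN (by omega)]
    have h2 : dist (f g) (f h) ≤ 2 ^ k * dist g h ^ (r : ℝ) := by
      rw [Real.dist_eq]
      refine h1.trans ?_
      rw [hd, hrr, inv_pow_rpow_eq, Nat.cast_pow, Nat.cast_two, pow_pow_eq_rpow,
        ← Real.rpow_neg two_pos.le, ← Real.rpow_natCast 2 k, ← Real.rpow_add two_pos]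
      apply Real.rpow_le_rpow_of_exponent_le one_le_two
      -- The subtraction truncates when `N < n`; the inequality still holds. The constant `2 ^ k`
      -- absorbs the `-1` in the number of common digits.
      have h3 : (2 : ℝ) ^ N / 2 ^ n ≤ 2 ^ (N - n) := by
        rw [div_le_iff₀ (by positivity), ← pow_add]
        exact pow_le_pow_right₀ one_le_two (by omega)
      have h4 := mul_le_mul_of_nonneg_left h3 (Nat.cast_nonneg (α := ℝ) k)
      have h5 : (2 ^ N : ℝ) * (k / 2 ^ n) = k * (2 ^ N / 2 ^ n) := by ring
      have h6 : (0 : ℝ) ≤ k / 2 ^ n := by positivity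
      rw [sub_mul, h5]
      linarith
    rw [edist_dist, edist_dist, ENNReal.ofReal_rpow_of_nonneg dist_nonneg r.coe_nonneg]
    refine (ENNReal.ofReal_le_ofReal h2).trans_eq ?_
    rw [ENNReal.ofReal_mul (by positivity), ENNReal.ofReal_pow (by norm_num)]
    norm_num
  have himage : Set.Icc (0 : ℝ) 1 ⊆ f '' {g : TreeAut | ∀ w, treeSection g w ∈ A} := by
    intro x hx
    obtain ⟨a, -, ha⟩ := Real.ofDigits_SurjOn (Nat.one_lt_two_pow hpos.ne') hx
    obtain ⟨h, hh, hb⟩ := exists_blockBits_eq Λ hΛ hA hess fun u => e.symm (a (wordIndex u))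
    refine ⟨h, hh, ?_⟩
    rw [← ha]
    simp only [f, hb, wordIndex_wordAt, Equiv.apply_symm_apply]
  have h1 : (1 : ENNReal) ≤ dimH (f '' {g : TreeAut | ∀ w, treeSection g w ∈ A}) := by
    have h2 : dimH (Set.Icc (0 : ℝ) 1) = 1 := by
      rw [Real.dimH_of_nonempty_interior (by simp [interior_Icc])]
      simp
    rw [← h2]
    exact dimH_mono himage
  have h3 := h1.trans (hf.dimH_image_le hrpos)
  rwa [ENNReal.le_div_iff_mul_le (by simp [hrpos.ne']) (by simp), one_mul] at h3

end Dimension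

/-! ### Additivity of functions on the automorphism group -/

/-- The automorphism with root label `c` and sections `s 0`, `s 1` at the letters. -/
def join (c : ZMod 2) (s : Fin 2 → TreeAut) : TreeAut :=
  ofPortrait fun w => match w with
    | [] => c
    | i :: w => portrait (s i) w

theorem portrait_join_nil (c : ZMod 2) (s : Fin 2 → TreeAut) : portrait (join c s) [] = c := by
  rw [join, portrait_ofPortrait]

theorem portrait_join_cons (c : ZMod 2) (s : Fin 2 → TreeAut) (i : Fin 2) (w : Word) :
    portrait (join c s) (i :: w) = portrait (s i) w := by
  rw [join, portrait_ofPortrait]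

theorem treeSection_join (c : ZMod 2) (s : Fin 2 → TreeAut) (i : Fin 2) :
    treeSection (join c s) [i] = s i :=
  ext_portrait fun w => by
    rw [portrait_treeSection, List.singleton_append, portrait_join_cons]

theorem join_cons (c : ZMod 2) (s : Fin 2 → TreeAut) (i : Fin 2) (w : Word) :
    join c s (i :: w) = move c i :: s i w := by
  rw [map_cons, portrait_join_nil, treeSection_join]

theorem join_mul_join (c : ZMod 2) (s t : Fin 2 → TreeAut) :
    join c s * join 0 t = join c (s * t) := by
  refine ext_portrait fun w => ?_
  cases w with
  | nil => rw [portrait_mul, map_nil]; simp only [portrait_join_nil, add_zero]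
  | cons i w =>
    rw [portrait_mul, join_cons, move_zero]
    simp only [portrait_join_cons, Pi.mul_apply, portrait_mul]

theorem join_portrait (g : TreeAut) :
    join (portrait g []) (fun i => treeSection g [i]) = g := by
  refine ext_portrait fun w => ?_
  cases w with
  | nil => rw [portrait_join_nil]
  | cons i w => rw [portrait_join_cons, portrait_treeSection, List.singleton_append]

theorem join_zero_one : join 0 1 = 1 := by
  refine ext_portrait fun w => ?_
  cases w with
  | nil => rw [portrait_join_nil, portrait_one]
  | cons i w => rw [portrait_join_cons, Pi.one_apply, portrait_one, portrait_one]

/-- A function with values in `C_2` that is multiplicative for right factors fixing the first level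
and that depends on finitely many labels only is additive in the portraits. -/
theorem additive_of_map_mul (n : ℕ) (F : TreeAut → ZMod 2)
    (hF : ∀ g s, portrait s [] = 0 → F (g * s) = F g + F s) (h0 : ∀ g, res n g = 1 → F g = 0)
    (g h k : TreeAut) (hk : ∀ w, portrait k w = portrait g w + portrait h w) :
    F k = F g + F h := by
  induction n generalizing F g h k with
  | zero =>
    have h1 : ∀ g, F g = 0 := fun g => h0 g (res_eq_one_iff.2 fun w hw => absurd hw (by simp))
    simp only [h1, add_zero]
  | succ n ih =>
    -- Restricted to elements living below one letter, `F` is multiplicative without restriction and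
    -- depends on one level fewer, so induction applies.
    have hsingle : ∀ i, ∀ g h k : TreeAut, (∀ w, portrait k w = portrait g w + portrait h w) →
        F (join 0 (Pi.mulSingle i k)) =
          F (join 0 (Pi.mulSingle i g)) + F (join 0 (Pi.mulSingle i h)) := by
      intro i
      apply ih (fun x => F (join 0 (Pi.mulSingle i x)))
      · intro x y _
        rw [Pi.mulSingle_mul, ← join_mul_join, hF _ _ (portrait_join_nil _ _)]
      · intro x hx
        refine h0 _ (res_eq_one_iff.2 fun w hw => ?_)
        cases w with
        | nil => rw [portrait_join_nil]
        | cons j w =>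
          rw [portrait_join_cons]
          rcases eq_or_ne j i with rfl | hj
          · rw [Pi.mulSingle_eq_same]
            exact res_eq_one_iff.1 hx w (by simpa using hw)
          · rw [Pi.mulSingle_eq_of_ne hj, portrait_one]
    -- The root swap stands leftmost, so both right factors fix the first level and `hF` applies.
    have hdecomp : ∀ g, F g = F (join (portrait g []) 1) +
        (F (join 0 (Pi.mulSingle 0 (treeSection g [0]))) +
          F (join 0 (Pi.mulSingle 1 (treeSection g [1])))) := by
      intro g
      have h1 : g = join (portrait g []) 1 * (join 0 (Pi.mulSingle 0 (treeSection g [0])) *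
          join 0 (Pi.mulSingle 1 (treeSection g [1]))) := by
        conv_lhs => rw [← join_portrait g]
        rw [join_mul_join, join_mul_join, one_mul]
        congr 1
        funext i
        fin_cases i <;> simp
      conv_lhs => rw [h1]
      rw [hF, hF _ _ (portrait_join_nil _ _)]
      rw [join_mul_join, portrait_join_nil]
    -- No multiplicativity at the root is needed: any map from `C_2` to `C_2` fixing zero is
    -- additive.
    have hroot : ∀ c c' : ZMod 2, F (join (c + c') 1) = F (join c 1) + F (join c' 1) := by
      have h1 : F (join 0 1) = 0 := by rw [join_zero_one]; exact h0 1 (map_one _)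
      intro c c'
      rcases eq_or_ne c 0 with rfl | hc
      · rw [h1, zero_add, zero_add]
      rcases eq_or_ne c' 0 with rfl | hc'
      · rw [h1, add_zero, add_zero]
      rw [zmod_two_eq_one hc, zmod_two_eq_one hc', CharTwo.add_self_eq_zero,
        CharTwo.add_self_eq_zero, h1]
    have hsec : ∀ i w, portrait (treeSection k [i]) w =
        portrait (treeSection g [i]) w + portrait (treeSection h [i]) w := fun i w => by
      simp only [portrait_treeSection, hk]
    rw [hdecomp k, hdecomp g, hdecomp h, hk [], hroot, hsingle 0 _ _ _ (hsec 0),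
      hsingle 1 _ _ _ (hsec 1)]
    ring

/-- The automorphism group acts transitively on the levels. -/
theorem exists_map_eq {v v' : Word} (h : v.length = v'.length) : ∃ g : TreeAut, g v = v' := by
  induction v generalizing v' with
  | nil => exact ⟨1, (List.length_eq_zero_iff.1 h.symm).symm⟩
  | cons a v ih =>
    cases v' with
    | nil => simp at h
    | cons b v' =>
      obtain ⟨g, hg⟩ := ih (v' := v') (by simpa using h)
      have hc : ∀ a b : Fin 2, ∃ c : ZMod 2, move c a = b := by decide
      obtain ⟨c, hc⟩ := hc a b
      exact ⟨join c fun _ => g, by rw [join_cons, hc, hg]⟩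

/-! ### The kernel of a large pattern group -/

/-- The action of `g` on the words of length `n`. -/
def levelEquiv (n : ℕ) (g : TreeAut) : Level n ≃ Level n where
  toFun w := ⟨g w.1, (length_map g w.1).trans w.2⟩
  invFun w := ⟨g⁻¹ w.1, (length_map g⁻¹ w.1).trans w.2⟩
  left_inv w := Subtype.ext (RelIso.inv_apply_self g w.1)
  right_inv w := Subtype.ext (RelIso.apply_inv_self g w.1)

/-- As `l` fixes `g w`, the label of `g⁻¹` at `g w` cancels that of `g` at `w`. -/
theorem labels_conj {n : ℕ} (g : TreeAut) {l : TreeAut} (hl : res n l = 1) :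
    labels n (g⁻¹ * (l * g)) = labels n l ∘ levelEquiv n g := by
  funext w
  have h1 : l (g w.1) = g w.1 :=
    res_eq_one_iff_map.1 hl _ ((length_map g w.1).trans w.2).le
  have h2 : portrait g⁻¹ (g w.1) + portrait g w.1 = 0 := by
    rw [← portrait_mul, inv_mul_cancel, portrait_one]
  change portrait _ w.1 = portrait l (g w.1)
  rw [portrait_mul, portrait_mul, RelIso.mul_apply, h1, add_left_comm, h2, add_zero]

theorem res_conj {n : ℕ} (g : TreeAut) {l : TreeAut} (hl : res n l = 1) :
    res n (g⁻¹ * (l * g)) = 1 := by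
  rw [map_mul, map_mul, hl, one_mul, ← map_mul, inv_mul_cancel, map_one]

theorem res_succ_eq {n : ℕ} {g h : TreeAut} (hr : res n g = res n h)
    (hl : labels n g = labels n h) : res (n + 1) g = res (n + 1) h := by
  refine res_eq_iff.2 fun w hw => ?_
  rcases (Nat.lt_succ_iff.1 hw).lt_or_eq with h1 | h1
  · exact res_eq_iff.1 hr w h1
  · exact congrFun hl ⟨w, h1⟩

section Kernel

open Module

variable {A : Subgroup TreeAut}

/-- The section at `i` need not lie in `A`, but essentiality supplies an element of `A` agreeing
with it up to level `n`; since `m < n`, this includes the labels on level `m`. -/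
theorem half_mem_kerLabels {n : ℕ}
    (hess : ∀ p ∈ A, ∀ i : Fin 2, ∃ q ∈ A, res n q = res n (treeSection p [i])) {m : ℕ}
    (hm : m < n) {v : Level (m + 1) → ZMod 2} (hv : v ∈ kerLabels A (m + 1)) (i : Fin 2) :
    (fun w : Level m => v (i ::ᵥ w)) ∈ kerLabels A m := by
  obtain ⟨p, hp, hp1, rfl⟩ := hv
  obtain ⟨q, hq, hqp⟩ := hess p hp i
  have h1 := res_eq_iff.1 hqp
  refine ⟨q, hq, res_eq_one_iff.2 fun w hw => ?_, funext fun w => ?_⟩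
  · rw [h1 w (hw.trans hm), portrait_treeSection]
    exact res_eq_one_iff.1 hp1 _ (by simpa using hw)
  · refine (h1 w.1 (w.2.trans_lt hm)).trans ?_
    rw [portrait_treeSection]
    rfl

/-- The two halves of an element of the kernel. -/
def halves {n : ℕ}
    (hess : ∀ p ∈ A, ∀ i : Fin 2, ∃ q ∈ A, res n q = res n (treeSection p [i])) {m : ℕ}
    (hm : m < n) (v : kerLabels A (m + 1)) : Fin 2 → kerLabels A m :=
  fun i => ⟨fun w => v.1 (i ::ᵥ w), half_mem_kerLabels hess hm v.2 i⟩

theorem halves_injective {n : ℕ}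
    (hess : ∀ p ∈ A, ∀ i : Fin 2, ∃ q ∈ A, res n q = res n (treeSection p [i])) {m : ℕ}
    (hm : m < n) : Function.Injective (halves hess hm) := by
  intro v v' h
  refine Subtype.ext (funext fun x => ?_)
  rw [← List.Vector.cons_head_tail x]
  exact congrFun (congrArg Subtype.val (congrFun h x.head)) x.tail

theorem finrank_kerLabels_succ_le {n : ℕ}
    (hess : ∀ p ∈ A, ∀ i : Fin 2, ∃ q ∈ A, res n q = res n (treeSection p [i])) {m : ℕ}
    (hm : m < n) : finrank (ZMod 2) (kerLabels A (m + 1)) ≤ 2 * finrank (ZMod 2) (kerLabels A m) := by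
  have h1 := Nat.card_le_card_of_injective _ (halves_injective hess hm)
  rw [Nat.card_fun, card_kerLabels, card_kerLabels, Nat.card_fin, ← pow_mul] at h1
  rw [mul_comm]
  exact (Nat.pow_le_pow_iff_right one_lt_two).1 h1

theorem finrank_level (n : ℕ) : finrank (ZMod 2) (Level n → ZMod 2) = 2 ^ n := by
  rw [finrank_fintype_fun_eq_card, card_vector, Fintype.card_fin]

theorem finrank_kerLabels_le (A : Subgroup TreeAut) (n : ℕ) :
    finrank (ZMod 2) (kerLabels A n) ≤ 2 ^ n :=
  (Submodule.finrank_le _).trans_eq (finrank_level n)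

/-- If the kernel on level `n + 1` consists of all vectors with halves in the kernel on level `n`,
then the patterns of size `n + 2` are determined by those of size `n + 1`. -/
theorem treeSection_mem_of_finrank_eq {n : ℕ}
    (hA : ∀ g h, res (n + 2) g = res (n + 2) h → g ∈ A → h ∈ A)
    (hess : ∀ p ∈ A, ∀ i : Fin 2, ∃ q ∈ A, res (n + 1) q = res (n + 1) (treeSection p [i]))
    (hfin : 2 * finrank (ZMod 2) (kerLabels A n) = finrank (ZMod 2) (kerLabels A (n + 1)))
    {g : TreeAut} (hg : ∀ w, ∃ a ∈ A, res (n + 1) a = res (n + 1) (treeSection g w)) (w : Word) :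
    treeSection g w ∈ A := by
  have hbij := (halves_injective hess (Nat.lt_succ_self n)).bijective_of_nat_card_le (by
    rw [Nat.card_fun, card_kerLabels, card_kerLabels, Nat.card_fin, ← pow_mul, ← hfin, mul_comm])
  obtain ⟨a, ha, hag⟩ := hg w
  have hk : res (n + 1) (a⁻¹ * treeSection g w) = 1 := by
    rw [map_mul, map_inv, hag, inv_mul_cancel]
  have hhalf : ∀ i : Fin 2, (fun v : Level n => labels (n + 1) (a⁻¹ * treeSection g w) (i ::ᵥ v)) ∈
      kerLabels A n := by
    intro i
    -- The section of `a⁻¹ * g_w` at `i` is that of `a⁻¹` at the image letter times `g_{wi}`; both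
    -- factors are approximated up to level `n + 1` inside `A`.
    obtain ⟨q, hq, hqa⟩ := hess a⁻¹ (A.inv_mem ha) (move (portrait (treeSection g w) []) i)
    obtain ⟨b, hb, hbg⟩ := hg (w ++ [i])
    have h1 : res (n + 1) (q * b) = res (n + 1) (treeSection (a⁻¹ * treeSection g w) [i]) := by
      have h2 : treeSection g w [i] = [move (portrait (treeSection g w) []) i] := by
        rw [map_cons, map_nil]
      rw [treeSection_mul, h2, treeSection_treeSection, map_mul, map_mul, hqa, hbg]
    have h3 := res_eq_iff.1 h1
    refine ⟨q * b, A.mul_mem hq hb, res_eq_one_iff.2 fun v hv => ?_, funext fun v => ?_⟩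
    · rw [h3 v (hv.trans (Nat.lt_succ_self n)), portrait_treeSection]
      exact res_eq_one_iff.1 hk _ (by simpa using hv)
    · refine (h3 v.1 (v.2.trans_lt (Nat.lt_succ_self n))).trans ?_
      rw [portrait_treeSection]
      rfl
  obtain ⟨l, hl⟩ := hbij.2 fun i => ⟨_, hhalf i⟩
  have hlab : labels (n + 1) (a⁻¹ * treeSection g w) = l.1 := by
    funext x
    rw [← List.Vector.cons_head_tail x]
    exact (congrFun (congrArg Subtype.val (congrFun hl x.head)) x.tail).symm
  have h4 := mem_of_labels_mem hA hk (hlab ▸ l.2)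
  simpa using A.mul_mem ha h4

/-- A pattern group with full kernels below level `n` maps onto the automorphisms of level `n`. -/
theorem exists_mem_res_eq {n : ℕ} (htop : ∀ m < n, kerLabels A m = ⊤) (g : TreeAut) :
    ∃ a ∈ A, res n a = res n g := by
  suffices h : ∀ m ≤ n, ∃ a ∈ A, res m a = res m g from h n le_rfl
  intro m
  induction m with
  | zero =>
    exact fun _ => ⟨1, A.one_mem, res_eq_iff.2 fun w hw => absurd hw (Nat.not_lt_zero _)⟩
  | succ m ih =>
    intro hm
    obtain ⟨a, ha, hag⟩ := ih (by omega)
    have h1 : res m (a⁻¹ * g) = 1 := by rw [map_mul, map_inv, hag, inv_mul_cancel]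
    have h2 : labels m (a⁻¹ * g) ∈ kerLabels A m := by
      rw [htop m (by omega)]
      exact Submodule.mem_top
    obtain ⟨l, hl, hl1, hlg⟩ := h2
    refine ⟨a * l, A.mul_mem ha hl, res_succ_eq ?_ ?_⟩
    · rw [map_mul, hl1, mul_one, hag]
    · rw [labels_mul a hl1, hlg, ← labels_mul a h1, mul_inv_cancel_left]

/-- Fullness descends: dimension `2 ^ (m + 1)` at level `m + 1` needs at least `2 ^ m` at level `m`,
by cutting into halves. -/
theorem kerLabels_eq_top {n : ℕ}
    (hess : ∀ p ∈ A, ∀ i : Fin 2, ∃ q ∈ A, res (n + 1) q = res (n + 1) (treeSection p [i]))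
    (hn : finrank (ZMod 2) (kerLabels A n) = 2 ^ n) {m : ℕ} (hm : m ≤ n) :
    kerLabels A m = ⊤ := by
  apply Submodule.eq_top_of_finrank_eq
  rw [finrank_level]
  induction hm using Nat.decreasingInduction with
  | self => exact hn
  | of_succ m hm ih =>
    have h1 := finrank_kerLabels_succ_le hess (m := m) (by omega)
    have h2 := finrank_kerLabels_le A m
    rw [ih, pow_succ] at h1
    omega

/-- Conjugation inside `A` permutes kernel labels through the action on level `n`, and by `hsurj`
every such action comes from `A`. -/
theorem comp_levelEquiv_mem {n : ℕ} (hsurj : ∀ g, ∃ a ∈ A, res n a = res n g)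
    {v : Level n → ZMod 2} (hv : v ∈ kerLabels A n) (g : TreeAut) :
    v ∘ levelEquiv n g ∈ kerLabels A n := by
  obtain ⟨l, hl, hl1, rfl⟩ := hv
  obtain ⟨a, ha, hag⟩ := hsurj g
  refine ⟨a⁻¹ * (l * a), A.mul_mem (A.inv_mem ha) (A.mul_mem hl ha), res_conj a hl1, ?_⟩
  rw [labels_conj a hl1]
  funext w
  have h1 : levelEquiv n a w = levelEquiv n g w :=
    Subtype.ext (res_eq_iff_map.1 hag w.1 w.2.le)
  simp only [Function.comp_apply, h1]

end Kernel

/-! ### Invariant subspaces of codimension two and additivity of the pattern group. -/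

section Codimension

open Module

variable {A : Subgroup TreeAut}

/-- The vector with a single nonzero label at `w`. -/
def unitLabel {n : ℕ} (w : Level n) : Level n → ZMod 2 := Pi.single w 1

theorem unitLabel_comp {n : ℕ} (g : TreeAut) (w : Level n) :
    unitLabel (levelEquiv n g w) ∘ levelEquiv n g = unitLabel w := by
  funext x
  simp only [unitLabel, Function.comp_apply, Pi.single_apply, EmbeddingLike.apply_eq_iff_eq]

/-- Over two scalars, the three conditions say that `x` and `y` are independent, hence a basis. -/
theorem eq_of_finrank_eq_two {E : Type*} [AddCommGroup E] [Module (ZMod 2) E]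
    (hE : finrank (ZMod 2) E = 2) {x y : E} (hx : x ≠ 0) (hy : y ≠ 0) (hxy : x + y ≠ 0) (z : E) :
    z = 0 ∨ z = x ∨ z = y ∨ z = x + y := by
  let f : (ZMod 2 × ZMod 2) →ₗ[ZMod 2] E :=
    (LinearMap.toSpanSingleton (ZMod 2) E x).coprod (LinearMap.toSpanSingleton (ZMod 2) E y)
  have hf : ∀ a b, f (a, b) = a • x + b • y := fun a b => by simp [f]
  have hcases : ∀ a : ZMod 2, a = 0 ∨ a = 1 := by decide
  have hinj : Function.Injective f := by
    rw [← LinearMap.ker_eq_bot, LinearMap.ker_eq_bot']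
    rintro ⟨a, b⟩ h
    rw [hf] at h
    rcases hcases a with rfl | rfl <;> rcases hcases b with rfl | rfl <;> simp_all
  have : FiniteDimensional (ZMod 2) E := FiniteDimensional.of_finrank_pos (by omega)
  have hsurj : Function.Surjective f :=
    (LinearMap.injective_iff_surjective_of_finrank_eq_finrank (by simp [hE])).1 hinj
  obtain ⟨⟨a, b⟩, rfl⟩ := hsurj z
  rw [hf]
  rcases hcases a with rfl | rfl <;> rcases hcases b with rfl | rfl <;> simp

/-- An invariant subspace of codimension two contains the sum of any two unit vectors in the same
half of the tree. -/
theorem unitLabel_add_mem {n : ℕ} {L : Submodule (ZMod 2) (Level (n + 1) → ZMod 2)}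
    (hL : finrank (ZMod 2) L + 2 = 2 ^ (n + 1))
    (hinv : ∀ v ∈ L, ∀ g : TreeAut, v ∘ levelEquiv (n + 1) g ∈ L) (i : Fin 2) (u u' : Level n) :
    unitLabel (i ::ᵥ u) + unitLabel (i ::ᵥ u') ∈ L := by
  by_contra hne
  have hadd : ∀ x y : Level (n + 1) → ZMod 2, x + y ∈ L → y + x ∈ L :=
    fun x y h => by rwa [add_comm y x]
  have hself : ∀ x : Level (n + 1) → ZMod 2, x + x = 0 := fun x => funext fun w =>
    CharTwo.add_self_eq_zero (x w)
  have htrans : ∀ x y z : Level (n + 1) → ZMod 2, x + y ∈ L → y + z ∈ L → x + z ∈ L := by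
    intro x y z h1 h2
    have h3 : x + z = (x + y) + (y + z) := by
      rw [add_assoc, ← add_assoc y, hself, zero_add]
    rw [h3]
    exact L.add_mem h1 h2
  have hmove : ∀ (g : TreeAut) (x y : Level (n + 1)), unitLabel x + unitLabel y ∈ L →
      unitLabel (levelEquiv _ g x) + unitLabel (levelEquiv _ g y) ∈ L := by
    intro g x y h
    have h1 : ∀ x, unitLabel x ∘ levelEquiv (n + 1) g⁻¹ = unitLabel (levelEquiv _ g x) := by
      intro x
      have h2 : levelEquiv (n + 1) g⁻¹ (levelEquiv (n + 1) g x) = x :=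
        Subtype.ext (RelIso.inv_apply_self g x.1)
      rw [← unitLabel_comp g⁻¹ (levelEquiv _ g x), h2]
    have h2 := hinv _ h g⁻¹
    rwa [Pi.add_comp, h1, h1] at h2
  -- By transitivity on the level, one unit vector in `L` would put all of them there.
  have hnot : ∀ x : Level (n + 1), unitLabel x ∉ L := by
    intro x hx
    have hall : ∀ y : Level (n + 1), unitLabel y ∈ L := by
      intro y
      obtain ⟨g, hg⟩ := exists_map_eq (y.2.trans x.2.symm)
      have h1 := hinv _ hx g
      have h2 : x = levelEquiv _ g y := Subtype.ext hg.symm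
      rwa [h2, unitLabel_comp] at h1
    exact hne (L.add_mem (hall _) (hall _))
  have hquot : finrank (ZMod 2) ((Level (n + 1) → ZMod 2) ⧸ L) = 2 := by
    have h1 := L.finrank_quotient_add_finrank
    rw [finrank_level] at h1
    omega
  have hfour : ∀ z, z ∈ L ∨ z + unitLabel (i ::ᵥ u) ∈ L ∨ z + unitLabel (i ::ᵥ u') ∈ L ∨
      z + (unitLabel (i ::ᵥ u) + unitLabel (i ::ᵥ u')) ∈ L := by
    intro z
    have hneg : ∀ x : Level (n + 1) → ZMod 2, -x = x := fun x =>
      neg_eq_of_add_eq_zero_left (hself x)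
    have hmk : ∀ x y : Level (n + 1) → ZMod 2, x + y ∈ L ↔ L.mkQ x = L.mkQ y := by
      intro x y
      rw [Submodule.mkQ_apply, Submodule.mkQ_apply, Submodule.Quotient.eq, sub_eq_add_neg, hneg]
    have hz : ∀ x : Level (n + 1) → ZMod 2, x ∈ L ↔ L.mkQ x = 0 := fun x => by
      rw [Submodule.mkQ_apply, Submodule.Quotient.mk_eq_zero]
    have h1 := eq_of_finrank_eq_two hquot (mt (hz _).2 (hnot (i ::ᵥ u)))
      (mt (hz _).2 (hnot (i ::ᵥ u'))) (by rw [← map_add]; exact mt (hz _).2 hne) (L.mkQ z)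
    rwa [← map_add, ← hz, ← hmk, ← hmk, ← hmk] at h1
  -- Modulo `L` the unit vector at `(1 - i)w` is one of three nonzero classes. An automorphism
  -- fixing `(1 - i)w` and moving `iu` to `iu'`, or back, excludes the classes of these two, leaving
  -- their sum.
  have hother : ∀ w : Level n, unitLabel ((1 - i) ::ᵥ w) +
      (unitLabel (i ::ᵥ u) + unitLabel (i ::ᵥ u')) ∈ L := by
    intro w
    have hi : 1 - i ≠ i := (by decide : ∀ i : Fin 2, 1 - i ≠ i) i
    have hmap : ∀ x y : Level n, ∃ g : TreeAut,
        levelEquiv (n + 1) g (i ::ᵥ x) = i ::ᵥ y ∧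
        levelEquiv (n + 1) g ((1 - i) ::ᵥ w) = (1 - i) ::ᵥ w := by
      intro x y
      obtain ⟨g, hg⟩ := exists_map_eq (x.2.trans y.2.symm)
      refine ⟨join 0 (Pi.mulSingle i g), Subtype.ext ?_, Subtype.ext ?_⟩
      · refine (join_cons _ _ _ _).trans ?_
        rw [Pi.mulSingle_eq_same, hg]
        rfl
      · refine (join_cons _ _ _ _).trans ?_
        rw [Pi.mulSingle_eq_of_ne hi]
        rfl
    rcases hfour (unitLabel ((1 - i) ::ᵥ w)) with h | h | h | h
    · exact absurd h (hnot _)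
    · obtain ⟨g, hg, hgw⟩ := hmap u u'
      have h1 := hmove g _ _ h
      rw [hg, hgw] at h1
      exact absurd (htrans _ _ _ (hadd _ _ h) h1) hne
    · obtain ⟨g, hg, hgw⟩ := hmap u' u
      have h1 := hmove g _ _ h
      rw [hg, hgw] at h1
      exact absurd (htrans _ _ _ (hadd _ _ h1) h) hne
    · exact h
  have hswap : ∀ w : Level n, levelEquiv (n + 1) (join 1 1) ((1 - i) ::ᵥ w) = i ::ᵥ w := by
    intro w
    refine Subtype.ext ((join_cons _ _ _ _).trans ?_)
    have hi : move 1 (1 - i) = i := (by decide : ∀ i : Fin 2, move 1 (1 - i) = i) i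
    rw [hi]
    rfl
  -- All unit vectors of the other half are thus congruent; swapping the halves contradicts `hne`.
  have h1 := hmove (join 1 1) _ _ (htrans _ _ _ (hother u) (hadd _ _ (hother u')))
  rw [hswap, hswap] at h1
  exact hne h1

/-- The sums of the labels over the two halves of level `n + 1`. -/
def halfSums (n : ℕ) : (Level (n + 1) → ZMod 2) →ₗ[ZMod 2] (Fin 2 → ZMod 2) where
  toFun v i := ∑ w : Level n, v (i ::ᵥ w)
  map_add' _ _ := funext fun _ => Finset.sum_add_distrib
  map_smul' _ _ := funext fun _ => (Finset.mul_sum _ _ _).symm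

/-- The only invariant subspace of codimension two is the space of vectors with half sums zero. -/
theorem eq_ker_halfSums {n : ℕ} {L : Submodule (ZMod 2) (Level (n + 1) → ZMod 2)}
    (hL : finrank (ZMod 2) L + 2 = 2 ^ (n + 1))
    (hinv : ∀ v ∈ L, ∀ g : TreeAut, v ∘ levelEquiv (n + 1) g ∈ L) :
    L = LinearMap.ker (halfSums n) := by
  symm
  apply Submodule.eq_of_le_of_finrank_le
  · intro v hv
    -- An arbitrary base word: vanishing half sums make its contributions cancel.
    let o : Level n := List.Vector.replicate n 0
    have hsum : v = ∑ i : Fin 2, ∑ w : Level n,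
        v (i ::ᵥ w) • (unitLabel (i ::ᵥ w) + unitLabel (i ::ᵥ o)) := by
      have h1 : ∀ i : Fin 2, ∑ w : Level n, v (i ::ᵥ w) • unitLabel (i ::ᵥ o) = 0 := by
        intro i
        have h2 : ∑ w : Level n, v (i ::ᵥ w) = 0 := congrFun (LinearMap.mem_ker.1 hv) i
        rw [← Finset.sum_smul, h2, zero_smul]
      simp only [smul_add, Finset.sum_add_distrib, h1, add_zero]
      funext x
      rw [← List.Vector.cons_head_tail x]
      generalize x.head = j
      generalize x.tail = z
      have h3 : ∀ (i : Fin 2) (w : Level n), (v (i ::ᵥ w) • unitLabel (i ::ᵥ w)) (j ::ᵥ z) =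
          if i = j then (if w = z then v (i ::ᵥ w) else 0) else 0 := by
        intro i w
        have h4 : j ::ᵥ z = i ::ᵥ w ↔ i = j ∧ w = z := by
          constructor
          · intro h
            exact ⟨by simpa using (congrArg List.Vector.head h).symm,
              by simpa using (congrArg List.Vector.tail h).symm⟩
          · rintro ⟨rfl, rfl⟩
            rfl
        simp only [unitLabel, Pi.smul_apply, Pi.single_apply, h4, smul_eq_mul]
        split_ifs <;> simp_all
      simp only [Finset.sum_apply, h3]
      simp
    rw [hsum]
    exact L.sum_mem fun i _ => L.sum_mem fun w _ =>
      L.smul_mem _ (unitLabel_add_mem hL hinv i w o)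
  · have h1 := (halfSums n).finrank_range_add_finrank_ker
    have h2 := Submodule.finrank_le (LinearMap.range (halfSums n))
    rw [finrank_level] at h1
    rw [finrank_fintype_fun_eq_card, Fintype.card_fin] at h2
    omega

theorem halfSums_comp {n : ℕ} {g : TreeAut} (hg : portrait g [] = 0)
    (v : Level (n + 1) → ZMod 2) : halfSums n (v ∘ levelEquiv (n + 1) g) = halfSums n v := by
  funext i
  refine Fintype.sum_equiv (levelEquiv n (treeSection g [i])) _ _ fun w => ?_
  have h1 : levelEquiv (n + 1) g (i ::ᵥ w) = i ::ᵥ levelEquiv n (treeSection g [i]) w := by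
    refine Subtype.ext ((map_cons g i w.1).trans ?_)
    rw [hg, move_zero]
    rfl
  rw [Function.comp_apply, h1]

/-- A pattern group whose kernel consists of the vectors with half sums zero and that maps onto the
automorphisms of the smaller tree has additive portraits. -/
theorem mem_of_portrait_eq_add {n : ℕ}
    (hA : ∀ g h, res (n + 2) g = res (n + 2) h → g ∈ A → h ∈ A)
    (hsurj : ∀ g, ∃ a ∈ A, res (n + 1) a = res (n + 1) g)
    (hker : kerLabels A (n + 1) = LinearMap.ker (halfSums n)) {g h k : TreeAut} (hg : g ∈ A)
    (hh : h ∈ A) (hk : ∀ w, portrait k w = portrait g w + portrait h w) : k ∈ A := by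
  choose a ha hag using hsurj
  have hres : ∀ {b g}, res (n + 1) b = res (n + 1) g → res (n + 1) (b⁻¹ * g) = 1 :=
    fun {b g} h => by rw [map_mul, map_inv, h, inv_mul_cancel]
  have hzero : ∀ {b}, b ∈ A → res (n + 1) b = 1 → halfSums n (labels (n + 1) b) = 0 := by
    intro b hb hb1
    rw [← LinearMap.mem_ker, ← hker]
    exact ⟨b, hb, hb1, rfl⟩
  let D : TreeAut → Fin 2 → ZMod 2 := fun g => halfSums n (labels (n + 1) ((a g)⁻¹ * g))
  -- `D` does not depend on the chosen approximation, since two of them differ by a kernel element,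
  -- whose half sums vanish.
  have hD : ∀ {b g}, b ∈ A → res (n + 1) b = res (n + 1) g →
      D g = halfSums n (labels (n + 1) (b⁻¹ * g)) := by
    intro b g hb hbg
    have h1 : b⁻¹ * g = b⁻¹ * a g * ((a g)⁻¹ * g) := by group
    have h2 : res (n + 1) (b⁻¹ * a g) = 1 := hres (hbg.trans (hag g).symm)
    rw [h1, labels_mul _ (hres (hag g)), map_add, hzero (A.mul_mem (A.inv_mem hb) (ha g)) h2,
      zero_add]
  have hmem : ∀ g, g ∈ A ↔ D g = 0 := by
    intro g
    constructor
    · intro hg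
      rw [hD hg rfl, inv_mul_cancel, labels_one, map_zero]
    · intro h0
      have h1 := mem_of_labels_mem hA (hres (hag g)) (by rw [hker]; exact h0)
      simpa using A.mul_mem (ha g) h1
  have hmul : ∀ g s, portrait s [] = 0 → D (g * s) = D g + D s := by
    intro g s hs
    have h1 : res (n + 1) (a g * a s) = res (n + 1) (g * s) := by
      rw [map_mul, map_mul, hag, hag]
    -- The discrepancy of `g` appears conjugated by `a s`, which fixes the first level and so
    -- preserves half sums.
    have h2 : (a g * a s)⁻¹ * (g * s) =
        (a s)⁻¹ * ((a g)⁻¹ * g * a s) * ((a s)⁻¹ * s) := by group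
    have h3 : portrait (a s) [] = 0 := by
      rw [← hs]
      exact res_eq_iff.1 (hag s) [] (Nat.succ_pos n)
    rw [hD (A.mul_mem (ha g) (ha s)) h1, h2, labels_mul _ (hres (hag s)), map_add,
      labels_conj _ (hres (hag g)), halfSums_comp h3]
  have htriv : ∀ g, res (n + 2) g = 1 → D g = 0 := by
    intro g hg
    rw [← hmem]
    exact hA 1 g (by rw [hg, map_one]) A.one_mem
  rw [hmem] at hg hh ⊢
  funext i
  have h1 := additive_of_map_mul (n + 2) (fun g => D g i)
    (fun g s hs => congrFun (hmul g s hs) i) (fun g hg => congrFun (htriv g hg) i) g h k hk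
  simpa [hg, hh] using h1

end Codimension

/-! ### Pattern groups as subgroups of the automorphism group of the infinite tree -/

theorem exists_mem_res_eq_treeSection {n : ℕ} {P : Subgroup (FinTreeAut (n + 1))}
    (hP : IsEssentialPatternGroup P) {p : TreeAut} (hp : p ∈ P.comap (res (n + 1))) (i : Fin 2) :
    ∃ q ∈ P.comap (res (n + 1)), res n q = res n (treeSection p [i]) := by
  obtain ⟨hd, hess⟩ := hP
  obtain ⟨q, hq, hqp⟩ := hess (res (n + 1) p) hp i
  refine ⟨extend q, by rwa [Subgroup.mem_comap, res_extend], ?_⟩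
  rw [← res_extend q] at hqp
  exact hqp

/-- This provides the smaller pattern group in the minimality argument; `hess` controls one level
more than is needed. -/
theorem isEssentialPatternGroup_map {n : ℕ} {A : Subgroup TreeAut}
    (hess : ∀ p ∈ A, ∀ i : Fin 2, ∃ q ∈ A, res (n + 1) q = res (n + 1) (treeSection p [i])) :
    IsEssentialPatternGroup (A.map (res (n + 1))) := by
  refine ⟨Nat.succ_pos n, ?_⟩
  rintro _ ⟨p, hp, rfl⟩ i
  obtain ⟨q, hq, hqp⟩ := hess p hp i
  exact ⟨res (n + 1) q, ⟨q, hq, rfl⟩, res_mono (Nat.le_succ n) hqp⟩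

/-- Portraits of sections are shifts of the portrait, so pointwise sums can be tested section by
section. -/
theorem hasAdditivePortraits_of_mem {H A : Subgroup TreeAut}
    (hH : ∀ g, g ∈ H ↔ ∀ w, treeSection g w ∈ A)
    (hA : ∀ g h k, g ∈ A → h ∈ A → (∀ w, portrait k w = portrait g w + portrait h w) → k ∈ A) :
    HasAdditivePortraits H := by
  refine ⟨{ carrier := portrait '' (H : Set TreeAut)
            zero_mem' := ⟨1, H.one_mem, funext portrait_one⟩
            add_mem' := ?_
            neg_mem' := ?_ }, rfl⟩
  · rintro _ _ ⟨g, hg, rfl⟩ ⟨h, hh, rfl⟩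
    refine ⟨ofPortrait (portrait g + portrait h), (hH _).2 fun w => ?_, portrait_ofPortrait _⟩
    refine hA _ _ _ ((hH g).1 hg w) ((hH h).1 hh w) fun v => ?_
    simp only [portrait_treeSection, portrait_ofPortrait, Pi.add_apply]
  · rintro _ ⟨g, hg, rfl⟩
    refine ⟨g, hg, funext fun w => ?_⟩
    rw [Pi.neg_apply, ZMod.neg_eq_self_mod_two]

/-- The dimension of the kernel of a pattern group whose group has Hausdorff dimension
`1 - 2 / 2 ^ (n + 1)`. -/
theorem finrank_kerLabels_of_dimH {A : Subgroup TreeAut} {n : ℕ}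
    (hA : ∀ g h, res (n + 2) g = res (n + 2) h → g ∈ A → h ∈ A)
    (hess : ∀ p ∈ A, ∀ i : Fin 2, ∃ q ∈ A, res (n + 1) q = res (n + 1) (treeSection p [i]))
    (hdim : dimH {g : TreeAut | ∀ w, treeSection g w ∈ A} =
      ENNReal.ofReal (1 - 2 / 2 ^ (n + 1))) :
    Module.finrank (ZMod 2) (kerLabels A (n + 1)) + 2 = 2 ^ (n + 1) := by
  have h1 := le_antisymm dimH_le_finrank_div (finrank_div_le_dimH hA hess)
  rw [hdim] at h1
  have h2 := congrArg ENNReal.toReal h1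
  have h3 : (2 : ℝ) ≤ 2 ^ (n + 1) := by
    rw [pow_succ]
    linarith [one_le_pow₀ (one_le_two (α := ℝ)) (n := n)]
  rw [ENNReal.toReal_ofReal (sub_nonneg.2 ((div_le_one (by positivity)).2 h3)),
    ENNReal.coe_toReal] at h2
  push_cast at h2
  field_simp at h2
  have h4 : ((Module.finrank (ZMod 2) (kerLabels A (n + 1)) + 2 : ℕ) : ℝ) =
      ((2 ^ (n + 1) : ℕ) : ℝ) := by
    push_cast
    linarith
  exact_mod_cast h4

end BinTree

/-- A finitely constrained group `H` of binary tree automorphisms that is defined by patterns of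
size `d ≥ 2` and has Hausdorff dimension `1 - 2 / 2 ^ (d - 1)`, with respect to the profinite
metric, has additive portraits. -/
theorem theorem1p2 (d : ℕ) (hd : 2 ≤ d) (H : Subgroup BinTree.TreeAut)
    (hH : BinTree.IsDefinedByPatternsOfSize H d)
    (hdim : dimH (H : Set BinTree.TreeAut) = ENNReal.ofReal (1 - 2 / 2 ^ (d - 1))) :
    BinTree.HasAdditivePortraits H := by
  obtain ⟨n, rfl⟩ := Nat.exists_eq_add_of_le' hd
  obtain ⟨⟨P, hP, hHP⟩, hmin⟩ := hH
  set A := P.comap (BinTree.res (n + 2)) with hAdef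
  have hA : ∀ g h, BinTree.res (n + 2) g = BinTree.res (n + 2) h → g ∈ A → h ∈ A := by
    intro g h hgh hg
    rw [hAdef, Subgroup.mem_comap] at hg ⊢
    rwa [← hgh]
  have hess : ∀ p ∈ A, ∀ i : Fin 2, ∃ q ∈ A,
      BinTree.res (n + 1) q = BinTree.res (n + 1) (BinTree.treeSection p [i]) :=
    fun p hp i => BinTree.exists_mem_res_eq_treeSection hP hp i
  have hHA : ∀ g, g ∈ H ↔ ∀ w, BinTree.treeSection g w ∈ A := fun g => by rw [hHP]; rfl
  have hset : (H : Set BinTree.TreeAut) = {g | ∀ w, BinTree.treeSection g w ∈ A} := Set.ext hHA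
  rw [hset] at hdim
  have hfin := BinTree.finrank_kerLabels_of_dimH hA hess hdim
  -- The dimension is `2 ^ n - 1` or `2 ^ n`; in the first case twice it equals the dimension one
  -- level below in the tree, and `H` is defined by patterns of size `n + 1`.
  have hfull : Module.finrank (ZMod 2) (BinTree.kerLabels A n) = 2 ^ n := by
    by_contra hne
    have h1 := BinTree.finrank_kerLabels_succ_le hess (Nat.lt_succ_self n)
    have h2 := BinTree.finrank_kerLabels_le A n
    rw [pow_succ] at hfin
    have h3 := hmin ⟨A.map (BinTree.res (n + 1)), BinTree.isEssentialPatternGroup_map hess, by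
      ext g
      rw [hHA]
      constructor
      · exact fun hg w => ⟨_, hg w, rfl⟩
      · exact fun hg w => BinTree.treeSection_mem_of_finrank_eq hA hess (by omega) hg w⟩
    omega
  have hsurj : ∀ g, ∃ a ∈ A, BinTree.res (n + 1) a = BinTree.res (n + 1) g :=
    BinTree.exists_mem_res_eq fun m hm =>
      BinTree.kerLabels_eq_top hess hfull (Nat.lt_succ_iff.1 hm)
  have hker := BinTree.eq_ker_halfSums hfin fun v hv g =>
    BinTree.comp_levelEquiv_mem hsurj hv g
  exact BinTree.hasAdditivePortraits_of_mem hHA fun g h k hg hh hk =>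
    BinTree.mem_of_portrait_eq_add hA hsurj hker hg hh hk
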